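/- Let $N\ge 1$ be an integer and $\alpha>-1$. An Orlicz function is a strictly convex function $\psi:[0,\infty)\to[0,\infty)$ with $\psi(0)=0$, continuous at $0$, and $\psi(x)/x\to\infty$ as $x\to\infty$; $\psi^{-1}$ denotes its inverse. For a finite positive measure $\mu$, $L^\psi(\mu)$ is the space of (classes of) measurable complex functions $f$ with $\int\psi(|f|/C)\,d\mu<\infty$ for some $C>0$, with the norm $\|f\|_{L^\psi(\mu)}=\inf\{C>0:\int\psi(|f|/C)\,d\mu\le 1\}$. Let $\mathbb{B}_N$ and $\mathbb{S}_N$ be the open unit ball and the unit sphere of $\mathbb{C}^N$, let $dv_\alpha(z)=c_\alpha(1-|z|^2)^\alpha dv(z)$, where $v$ is the normalized Lebesgue measure on $\mathbb{B}_N$ and $c_\alpha=\frac{\Gamma(N+\alpha+1)}{N!\,\Gamma(\alpha+1)}$, and let $A^\psi_\alpha(\mathbb{B}_N)$ be the space of holomorphic functions on $\mathbb{B}_N$ that belong to $L^\psi(v_\alpha)$, with the norm of $L^\psi(v_\alpha)$. For $\zeta\in\mathbb{S}_N$ and $h>0$ let $$W(\zeta,h)=\Big\{z\in\mathbb{B}_N\setminus\{0\}:\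 1-|z|<h,\ \big|1-\big\langle \zeta,\tfrac{z}{|z|}\big\rangle\big|<h\Big\},$$ and for a finite positive Borel measure $\mu$ on $\mathbb{B}_N$ let $$\varrho_\mu(h)=\sup_{\xi\in\mathbb{S}_N}\mu(W(\xi,h)),\qquad K_{\mu,\alpha}(h)=\sup_{0<t\le h}\frac{\varrho_\mu(t)}{t^{N+1+\alpha}}.$$ Theorem 2.9. Let $\mu$ be a finite positive Borel measure on $\mathbb{B}_N$ and let $\psi_1,\psi_2$ be two Orlicz functions. (1) If the inclusion $A^{\psi_1}_\alpha(\mathbb{B}_N)\subset L^{\psi_2}(\mu)$ holds and is compact (every sequence in the unit ball of $A^{\psi_1}_\alpha(\mathbb{B}_N)$ has a subsequence that converges in the norm of $L^{\psi_2}(\mu)$), then for every $A>0$ $$\varrho_\mu(h)=o_{h\to0}\left(\frac{1}{\psi_2\big(A\psi_1^{-1}(1/h^{N+1+\alpha})\big)}\right).\tag{a}$$ (2) If for every $A>0$ $$K_{\mu,\alpha}(h)=o_{h\to0}\left(\frac{1/h^{N+1+\alpha}}{\psi_2\big(A\psi_1^{-1}(1/h^{N+1+\alpha})\big)}\right),\tag{b}$$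 then the inclusion $A^{\psi_1}_\alpha(\mathbb{B}_N)\subset L^{\psi_2}(\mu)$ holds and is compact. (3) If in addition $\psi_1=\psi_2=\psi$ satisfies the $\nabla_0$-Condition, that is, there exist $x_0>0$ and $C\ge1$ such that $\frac{\psi(2x)}{\psi(x)}\le\frac{\psi(2Cy)}{\psi(y)}$ whenever $x_0\le x\le y$, then (a) holds for every $A>0$ if and only if (b) holds for every $A>0$. -/

import Mathlib

open Set Filter Topology MeasureTheory
open scoped ENNReal

namespace BergmanOrlicz

/-- An Orlicz function `ψ : [0, ∞) → [0, ∞)`. It is represented by a function on `ℝ` of which only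
the restriction to `[0, ∞)` matters: strictly convex, nonnegative, vanishing at `0`, continuous
at `0`, and with `ψ x / x → ∞` as `x → ∞`. -/
structure IsOrlicz (ψ : ℝ → ℝ) : Prop where
  nonneg : ∀ x, 0 ≤ x → 0 ≤ ψ x
  strictConvexOn : StrictConvexOn ℝ (Ici 0) ψ
  map_zero : ψ 0 = 0
  continuous_zero : ContinuousWithinAt ψ (Ici 0) 0
  superlinear : Tendsto (fun x => ψ x / x) atTop atTop

/-- The inverse function `ψ⁻¹ : [0, ∞) → [0, ∞)`. An Orlicz function is a bijection of `[0, ∞)`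
onto itself, so this is a genuine inverse at every nonnegative argument. -/
noncomputable def orliczInv (ψ : ℝ → ℝ) : ℝ → ℝ :=
  Function.invFunOn ψ (Ici 0)

/-- The `∇₀`-Condition. -/
def Nabla0 (ψ : ℝ → ℝ) : Prop :=
  ∃ x₀ : ℝ, 0 < x₀ ∧ ∃ C : ℝ, 1 ≤ C ∧
    ∀ x y : ℝ, x₀ ≤ x → x ≤ y → ψ (2 * x) / ψ x ≤ ψ (2 * C * y) / ψ y

section Orlicz

variable {X : Type*} [MeasurableSpace X]

/-- The modular `∫ ψ(|f| / C) dμ`, with values in `[0, ∞]`. -/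
noncomputable def modular (ψ : ℝ → ℝ) (μ : Measure X) (f : X → ℂ) (C : ℝ) : ℝ≥0∞ :=
  ∫⁻ x, ENNReal.ofReal (ψ (‖f x‖ / C)) ∂μ

/-- Membership of (the class of) `f` in the Orlicz space `L^ψ(μ)`. -/
def MemOrlicz (ψ : ℝ → ℝ) (μ : Measure X) (f : X → ℂ) : Prop :=
  AEStronglyMeasurable f μ ∧ ∃ C : ℝ, 0 < C ∧ modular ψ μ f C < ∞

/-- The Luxemburg norm, with values in `[0, ∞]`; it is finite on `L^ψ(μ)`. -/
noncomputable def luxemburgNorm (ψ : ℝ → ℝ) (μ : Measure X) (f : X → ℂ) : ℝ≥0∞ :=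
  ⨅ (C : ℝ) (_ : 0 < C ∧ modular ψ μ f C ≤ 1), ENNReal.ofReal C

end Orlicz

/-- The space `ℂ^N` with its Hermitian norm. -/
abbrev E (N : ℕ) : Type := EuclideanSpace ℂ (Fin N)

/-- The open unit ball `𝔹_N` of `ℂ^N`. -/
def unitBall (N : ℕ) : Set (E N) := Metric.ball 0 1

/-- The unit sphere `𝕊_N` of `ℂ^N`. -/
def unitSphere (N : ℕ) : Set (E N) := Metric.sphere 0 1

/-- The volume Lebesgue measure on `𝔹_N`, normalized to have mass one. -/
noncomputable def normalizedVolume (N : ℕ) : Measure (E N) :=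
  (volume (unitBall N))⁻¹ • volume.restrict (unitBall N)

/-- The weighted measure `dv_α = c_α (1 - |z|²)^α dv`, with the constant
`c_α = Γ(N + α + 1) / (N! Γ(α + 1))`; it is a probability measure for `α > -1`. -/
noncomputable def weightedVolume (N : ℕ) (α : ℝ) : Measure (E N) :=
  (normalizedVolume N).withDensity fun z =>
    ENNReal.ofReal
      (Real.Gamma (N + α + 1) / ((N.factorial : ℝ) * Real.Gamma (α + 1)) * (1 - ‖z‖ ^ 2) ^ α)

/-- Membership in the weighted Bergman-Orlicz space `A^ψ_α(𝔹_N)`: holomorphic on the ball and in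
`L^ψ(v_α)`. Values outside the ball are irrelevant. -/
def MemBergmanOrlicz (N : ℕ) (α : ℝ) (ψ : ℝ → ℝ) (f : E N → ℂ) : Prop :=
  DifferentiableOn ℂ f (unitBall N) ∧ MemOrlicz ψ (weightedVolume N α) f

/-- The inclusion `A^{ψ₁}_α(𝔹_N) ⊂ L^{ψ₂}(μ)` holds and is a compact operator: every sequence in
the unit ball of `A^{ψ₁}_α(𝔹_N)` has a subsequence that converges in the norm of `L^{ψ₂}(μ)`
to an element of `L^{ψ₂}(μ)`. -/
def CompactEmbedding (N : ℕ) (α : ℝ) (ψ₁ ψ₂ : ℝ → ℝ) (μ : Measure (E N)) : Prop :=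
  (∀ f : E N → ℂ, MemBergmanOrlicz N α ψ₁ f → MemOrlicz ψ₂ μ f) ∧
  ∀ f : ℕ → E N → ℂ,
    (∀ n, MemBergmanOrlicz N α ψ₁ (f n) ∧
      luxemburgNorm ψ₁ (weightedVolume N α) (f n) ≤ 1) →
    ∃ (g : E N → ℂ) (k : ℕ → ℕ), MemOrlicz ψ₂ μ g ∧ StrictMono k ∧
      Tendsto (fun n => luxemburgNorm ψ₂ μ (fun z => f (k n) z - g z)) atTop (𝓝 0)

/-- The non-isotropic distance `d(ζ, ξ) = √|1 - ⟨ζ, ξ⟩|`. -/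
noncomputable def nonisoDist {N : ℕ} (ζ ξ : E N) : ℝ :=
  Real.sqrt ‖(1 : ℂ) - inner ℂ ξ ζ‖

/-- The "true" ball `Q(ζ, h)` of the sphere `𝕊_N`. -/
def sphereBall {N : ℕ} (ζ : E N) (h : ℝ) : Set (E N) :=
  {ξ | ξ ∈ unitSphere N ∧ nonisoDist ζ ξ ^ 2 < h}

/-- The Carleson window `W(ζ, h)`. -/
def carlesonWindow {N : ℕ} (ζ : E N) (h : ℝ) : Set (E N) :=
  {z | z ∈ unitBall N ∧ 1 - ‖z‖ < h ∧ ((‖z‖⁻¹ : ℝ) : ℂ) • z ∈ sphereBall ζ h}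

/-- The function `ϱ_μ(h) = sup_{ξ ∈ 𝕊_N} μ(W(ξ, h))`. -/
noncomputable def rho {N : ℕ} (μ : Measure (E N)) (h : ℝ) : ℝ≥0∞ :=
  ⨆ ξ ∈ unitSphere N, μ (carlesonWindow ξ h)

/-- The function `K_{μ,α}(h) = sup_{0 < t ≤ h} ϱ_μ(t) / t^{N+1+α}`, possibly infinite. -/
noncomputable def carlesonK {N : ℕ} (μ : Measure (E N)) (α : ℝ) (h : ℝ) : ℝ≥0∞ :=
  ⨆ t ∈ Ioc (0 : ℝ) h, rho μ t / ENNReal.ofReal (t ^ ((N : ℝ) + 1 + α))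

/-- `F(h) = o(g(h))` as `h → 0⁺`, for `F` with values in `[0, ∞]` and `g` positive near `0⁺`. -/
def LittleOAtZero (F : ℝ → ℝ≥0∞) (g : ℝ → ℝ) : Prop :=
  ∀ ε : ℝ, 0 < ε → ∀ᶠ h in 𝓝[>] (0 : ℝ), F h ≤ ENNReal.ofReal (ε * g h)

/-- For every `A > 0`: `ϱ_μ(h) = o(1 / ψ₂(A ψ₁⁻¹(1 / h^{N+1+α})))` as `h → 0`. -/
def RhoCondition {N : ℕ} (α : ℝ) (ψ₁ ψ₂ : ℝ → ℝ) (μ : Measure (E N)) : Prop :=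
  ∀ A : ℝ, 0 < A → LittleOAtZero (rho μ)
    (fun h => 1 / ψ₂ (A * orliczInv ψ₁ (1 / h ^ ((N : ℝ) + 1 + α))))

/-- For every `A > 0`:
`K_{μ,α}(h) = o((1 / h^{N+1+α}) / ψ₂(A ψ₁⁻¹(1 / h^{N+1+α})))` as `h → 0`. -/
def KCondition {N : ℕ} (α : ℝ) (ψ₁ ψ₂ : ℝ → ℝ) (μ : Measure (E N)) : Prop :=
  ∀ A : ℝ, 0 < A → LittleOAtZero (carlesonK μ α)
    (fun h => (1 / h ^ ((N : ℝ) + 1 + α)) /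
      ψ₂ (A * orliczInv ψ₁ (1 / h ^ ((N : ℝ) + 1 + α))))

end BergmanOrlicz

/-!
All three parts compare, at a boundary scale `h`, the mass that `μ` gives to a Carleson window with
the order `h ^ (N + 1 + α)` of the mass that `v_α` gives to it.

*Necessity.* The powers `testFun` of `h / (1 - ⟨z, (1 - h) ξ⟩)` are bounded by one, are bounded
below on the window `W(ξ, h)`, and have `L¹(v_α)`-norm of order `h ^ (N + 1 + α)`
(`exists_lintegral_testFun_le`). Since `ψ₁ (κ x) ≤ κ ψ₁ x` for `κ ≤ 1`, their multiples by a
constant times `ψ₁⁻¹ (1 / h ^ (N + 1 + α))` lie in the unit ball, and they tend to zero pointwise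
as `h → 0`. Compactness makes them small in `L^{ψ₂}(μ)` along a subsequence, and Markov's
inequality on the window gives the condition on `ϱ_μ` (`CompactEmbedding.rhoCondition`).

*Sufficiency.* Every `z` in the ball has an anisotropic neighbourhood `adaptedNhd z` of
`v_α`-measure of order at least `(1 - |z|²) ^ (N + 1 + α)` whose displacements form a circled set.
Averaging over rotations turns the mean value property on circles and Jensen's inequality into a
sub-mean value inequality for `ψ₁ (|f| / C)` over this neighbourhood (`exists_submean`). Inserting
it into `∫ ψ₂ (|f| / δ) dμ` and exchanging the integrals, the points `z` whose neighbourhood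
contains a given `w` lie in one window. The growth `ψ₁ (|f(z)| / C) ≲ (1 - |z|²) ^ (-(N + 1 + α))`
allows the condition on `K_{μ,α}` to be applied at the scale `h` for which `1 / h ^ (N + 1 + α)`
is proportional to `ψ₁ (|f(z)| / C)`; this is where the monotonicity of `K_{μ,α}` enters, and no
maximal function is needed. The outcome is a tail `∫_{|f| > R} ψ₂ (|f| / δ) dμ` that is small
uniformly over bounded sets (`exists_tail_le`). Together with Montel's theorem, Fatou's lemma and
bounded convergence this gives the compactness of the inclusion (`KCondition.compactEmbedding`).

*Equivalence.* Iterating the `∇₀`-condition yields `ψ (A x) / ψ x ≤ ψ (B y) / ψ y` for `x ≤ y`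
with a larger constant `B`, so that the majorant of `ϱ_μ(t) / t ^ (N + 1 + α)` at `t ≤ h` is at
most the majorant at `h` (`RhoCondition.kCondition`).
-/

namespace BergmanOrlicz

/-! ### Orlicz functions and their inverses -/

namespace IsOrlicz

variable {ψ : ℝ → ℝ}

theorem convexOn (h : IsOrlicz ψ) : ConvexOn ℝ (Ici 0) ψ := h.strictConvexOn.convexOn

theorem map_mul_le (h : IsOrlicz ψ) {κ x : ℝ} (hκ : 0 ≤ κ) (hκ' : κ ≤ 1) (hx : 0 ≤ x) :
    ψ (κ * x) ≤ κ * ψ x := by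
  have := h.convexOn.2 (mem_Ici.2 hx) (mem_Ici.2 le_rfl) hκ (sub_nonneg.2 hκ') (by ring)
  simpa [h.map_zero] using this

theorem map_add_div_two_le (h : IsOrlicz ψ) {x y : ℝ} (hx : 0 ≤ x) (hy : 0 ≤ y) :
    ψ ((x + y) / 2) ≤ (ψ x + ψ y) / 2 := by
  have := h.convexOn.2 (mem_Ici.2 hx) (mem_Ici.2 hy) (by norm_num : (0 : ℝ) ≤ 1 / 2)
    (by norm_num : (0 : ℝ) ≤ 1 / 2) (by norm_num)
  simp only [smul_eq_mul] at this
  rw [show (x + y) / 2 = 1 / 2 * x + 1 / 2 * y by ring]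
  linarith

theorem pos (h : IsOrlicz ψ) {x : ℝ} (hx : 0 < x) : 0 < ψ x := by
  have := h.strictConvexOn.2 (mem_Ici.2 hx.le) (mem_Ici.2 le_rfl) hx.ne'
    (by norm_num : (0 : ℝ) < 1 / 2) (by norm_num : (0 : ℝ) < 1 / 2) (by norm_num)
  simp only [smul_eq_mul, h.map_zero, mul_zero, add_zero] at this
  have h2 := h.nonneg (1 / 2 * x) (by positivity)
  linarith

theorem strictMonoOn (h : IsOrlicz ψ) : StrictMonoOn ψ (Ici 0) := by
  intro x hx y hy hxy
  have hx : 0 ≤ x := hx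
  have hy : 0 < y := hx.trans_lt hxy
  have h1 := h.map_mul_le (κ := x / y) (x := y) (by positivity)
    (by rw [div_le_one hy]; exact hxy.le)
    hy.le
  rw [div_mul_cancel₀ _ hy.ne'] at h1
  refine h1.trans_lt ?_
  have : x / y < 1 := by rwa [div_lt_one hy]
  nlinarith [h.pos hy]

theorem mono (h : IsOrlicz ψ) {x y : ℝ} (hx : 0 ≤ x) (hxy : x ≤ y) : ψ x ≤ ψ y :=
  h.strictMonoOn.monotoneOn (mem_Ici.2 hx) (mem_Ici.2 (hx.trans hxy)) hxy

theorem le_of_map_le (h : IsOrlicz ψ) {x y : ℝ} (hx : 0 ≤ x) (hy : 0 ≤ y) (hxy : ψ x ≤ ψ y) :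
    x ≤ y :=
  (h.strictMonoOn.le_iff_le (mem_Ici.2 hx) (mem_Ici.2 hy)).1 hxy

theorem continuousOn (h : IsOrlicz ψ) : ContinuousOn ψ (Ici 0) := by
  intro x hx
  rcases (mem_Ici.1 hx).eq_or_lt with rfl | hx
  · exact h.continuous_zero
  · have := h.convexOn.continuousOn_interior
    rw [interior_Ici] at this
    exact (this.continuousAt (Ioi_mem_nhds hx)).continuousWithinAt

theorem continuous_comp (h : IsOrlicz ψ) {X : Type*} [TopologicalSpace X] {u : X → ℝ}
    (hu : Continuous u) (hu0 : ∀ x, 0 ≤ u x) : Continuous fun x => ψ (u x) :=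
  h.continuousOn.comp_continuous hu hu0

theorem continuous_norm_div (h : IsOrlicz ψ) {C : ℝ} (hC : 0 ≤ C) :
    Continuous fun x : ℂ => ψ (‖x‖ / C) :=
  h.continuous_comp (by fun_prop) fun _ => by positivity

/-- Superlinearity with slope one, which is all that compactness needs. -/
theorem exists_le_map (h : IsOrlicz ψ) : ∃ x₀ : ℝ, 0 < x₀ ∧ ∀ x, x₀ ≤ x → x ≤ ψ x := by
  obtain ⟨a, ha⟩ := (h.superlinear.eventually_ge_atTop 1).exists_forall_of_atTop
  refine ⟨max a 1, by positivity, fun x hx => ?_⟩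
  have hx1 : 0 < x := by linarith [le_max_right a 1]
  have := ha x ((le_max_left _ _).trans hx)
  rwa [le_div_iff₀ hx1, one_mul] at this

theorem exists_map_eq (h : IsOrlicz ψ) {y : ℝ} (hy : 0 ≤ y) : ∃ x ∈ Ici (0 : ℝ), ψ x = y := by
  obtain ⟨x₀, hx₀, hx⟩ := h.exists_le_map
  have hb : 0 ≤ max x₀ y := hy.trans (le_max_right _ _)
  have := intermediate_value_Icc hb (h.continuousOn.mono Icc_subset_Ici_self)
  obtain ⟨x, hx1, hx2⟩ := this ⟨by rw [h.map_zero]; exact hy,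
    (le_max_right x₀ y).trans (hx _ (le_max_left _ _))⟩
  exact ⟨x, hx1.1, hx2⟩

theorem orliczInv_nonneg (h : IsOrlicz ψ) {y : ℝ} (hy : 0 ≤ y) : 0 ≤ orliczInv ψ y :=
  Function.invFunOn_mem (h.exists_map_eq hy)

theorem map_orliczInv (h : IsOrlicz ψ) {y : ℝ} (hy : 0 ≤ y) : ψ (orliczInv ψ y) = y :=
  Function.invFunOn_eq (h.exists_map_eq hy)

theorem orliczInv_pos (h : IsOrlicz ψ) {y : ℝ} (hy : 0 < y) : 0 < orliczInv ψ y := by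
  refine (h.orliczInv_nonneg hy.le).lt_of_ne fun h0 => ?_
  have := h.map_orliczInv hy.le
  rw [← h0, h.map_zero] at this
  exact hy.ne this

theorem orliczInv_le (h : IsOrlicz ψ) {x y : ℝ} (hy : 0 ≤ y) (hx : 0 ≤ x) (hxy : y ≤ ψ x) :
    orliczInv ψ y ≤ x :=
  h.le_of_map_le (h.orliczInv_nonneg hy) hx (by rwa [h.map_orliczInv hy])

theorem le_orliczInv (h : IsOrlicz ψ) {x y : ℝ} (hy : 0 ≤ y) (hx : 0 ≤ x) (hxy : ψ x ≤ y) :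
    x ≤ orliczInv ψ y :=
  h.le_of_map_le hx (h.orliczInv_nonneg hy) (by rwa [h.map_orliczInv hy])

theorem orliczInv_mono (h : IsOrlicz ψ) {x y : ℝ} (hx : 0 ≤ x) (hxy : x ≤ y) :
    orliczInv ψ x ≤ orliczInv ψ y :=
  h.orliczInv_le hx (h.orliczInv_nonneg (hx.trans hxy)) (by rwa [h.map_orliczInv (hx.trans hxy)])

end IsOrlicz

section Modular

variable {X : Type*} [MeasurableSpace X] {ψ : ℝ → ℝ} {μ : Measure X} {f g : X → ℂ}

theorem modular_mono (h : IsOrlicz ψ) {C C' : ℝ} (hC : 0 < C) (hCC' : C ≤ C') :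
    modular ψ μ f C' ≤ modular ψ μ f C :=
  lintegral_mono fun x => ENNReal.ofReal_le_ofReal <|
    h.mono (div_nonneg (norm_nonneg _) (hC.le.trans hCC')) (by gcongr)

/-- By convexity, dividing by a larger constant divides the modular. -/
theorem modular_mul_le (h : IsOrlicz ψ) {C M : ℝ} (hC : 0 < C) (hM : 1 ≤ M) :
    modular ψ μ f (C * M) ≤ ENNReal.ofReal M⁻¹ * modular ψ μ f C := by
  unfold modular
  rw [← lintegral_const_mul' _ _ ENNReal.ofReal_ne_top]
  refine lintegral_mono fun x => ?_
  rw [← ENNReal.ofReal_mul (by positivity)]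
  refine ENNReal.ofReal_le_ofReal ?_
  have := h.map_mul_le (κ := M⁻¹) (x := ‖f x‖ / C) (by positivity) (inv_le_one_of_one_le₀ hM)
    (by positivity)
  convert this using 2
  field_simp

theorem modular_le_one_of_luxemburgNorm_lt (h : IsOrlicz ψ) {C : ℝ} 
    (hf : luxemburgNorm ψ μ f < ENNReal.ofReal C) : modular ψ μ f C ≤ 1 := by
  simp only [luxemburgNorm, iInf_lt_iff] at hf
  obtain ⟨C', ⟨hC', h1⟩, h2⟩ := hf
  rw [ENNReal.ofReal_lt_ofReal_iff_of_nonneg hC'.le] at h2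
  exact (modular_mono h hC' h2.le).trans h1

theorem luxemburgNorm_le {C : ℝ} (hC : 0 < C) (hf : modular ψ μ f C ≤ 1) :
    luxemburgNorm ψ μ f ≤ ENNReal.ofReal C :=
  iInf₂_le C ⟨hC, hf⟩

theorem MemOrlicz.exists_modular_le_one (h : IsOrlicz ψ) (hf : MemOrlicz ψ μ f) :
    ∃ C : ℝ, 0 < C ∧ modular ψ μ f C ≤ 1 := by
  obtain ⟨-, C, hC, hfin⟩ := hf
  set m := (modular ψ μ f C).toReal
  have hm : modular ψ μ f C = ENNReal.ofReal m := (ENNReal.ofReal_toReal hfin.ne).symm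
  have hm0 : 0 ≤ m := ENNReal.toReal_nonneg
  refine ⟨C * (m + 1), by positivity, (modular_mul_le h hC (by linarith)).trans ?_⟩
  rw [hm, ← ENNReal.ofReal_mul (by positivity), ENNReal.ofReal_le_one,
    inv_mul_le_iff₀ (by positivity)]
  linarith

theorem modular_sub_le (h : IsOrlicz ψ) (hf : AEStronglyMeasurable f μ) {C : ℝ} (hC : 0 < C)
    (hf1 : modular ψ μ f C ≤ 1) (hg1 : modular ψ μ g C ≤ 1) :
    modular ψ μ (fun x => f x - g x) (2 * C) ≤ 1 := by
  have key : ∀ x, ENNReal.ofReal (ψ (‖f x - g x‖ / (2 * C))) ≤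
      2⁻¹ * (ENNReal.ofReal (ψ (‖f x‖ / C)) + ENNReal.ofReal (ψ (‖g x‖ / C))) := by
    intro x
    have hx := h.nonneg (‖f x‖ / C) (by positivity)
    have hy := h.nonneg (‖g x‖ / C) (by positivity)
    rw [← ENNReal.ofReal_add hx hy, show (2⁻¹ : ℝ≥0∞) = ENNReal.ofReal 2⁻¹ by
      rw [ENNReal.ofReal_inv_of_pos two_pos]; simp, ← ENNReal.ofReal_mul (by norm_num)]
    refine ENNReal.ofReal_le_ofReal ?_
    calc ψ (‖f x - g x‖ / (2 * C)) ≤ ψ ((‖f x‖ / C + ‖g x‖ / C) / 2) := by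
          refine h.mono (by positivity) ?_
          rw [← add_div, div_div, mul_comm C 2]
          gcongr
          exact norm_sub_le _ _
      _ ≤ _ := by
          linarith [h.map_add_div_two_le (x := ‖f x‖ / C) (y := ‖g x‖ / C) (by positivity)
            (by positivity)]
  have hm : AEMeasurable (fun x => ENNReal.ofReal (ψ (‖f x‖ / C))) μ :=
    ((h.continuous_norm_div hC.le).measurable.comp_aemeasurable hf.aemeasurable).ennreal_ofReal
  calc modular ψ μ (fun x => f x - g x) (2 * C)
      ≤ ∫⁻ x, 2⁻¹ * (ENNReal.ofReal (ψ (‖f x‖ / C)) + ENNReal.ofReal (ψ (‖g x‖ / C))) ∂μ :=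
        lintegral_mono key
    _ = 2⁻¹ * (modular ψ μ f C + modular ψ μ g C) := by
        rw [lintegral_const_mul' _ _ (by simp), lintegral_add_left' hm]; rfl
    _ ≤ 2⁻¹ * (1 + 1) := by gcongr
    _ = 1 := by rw [one_add_one_eq_two]; exact ENNReal.inv_mul_cancel (by simp) (by simp)

end Modular

/-! ### Anisotropic dilations -/

variable {N : ℕ}

/-- The complex linear map of `ℂ^N` that multiplies the direction `e` by `a` and the orthogonal
complement of `e` by `b`, when `e` is a unit vector and `b ≠ 0`. -/
noncomputable def anisoDilation (e : E N) (a b : ℝ) : E N →ₗ[ℂ] E N :=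
  (b : ℂ) • LinearMap.transvection (((a / b - 1 : ℝ) : ℂ) • (innerSL ℂ e).toLinearMap) e

theorem anisoDilation_apply {e : E N} {a b : ℝ} (hb : b ≠ 0) (x : E N) :
    anisoDilation e a b x = (b : ℂ) • x + (((a - b : ℝ) : ℂ) * inner ℂ e x) • e := by
  simp only [anisoDilation, LinearMap.smul_apply, LinearMap.transvection.apply, smul_add, smul_smul]
  congr 2
  have : (b : ℂ) ≠ 0 := by exact_mod_cast hb
  simp
  field_simp

theorem inner_anisoDilation {e : E N} (he : ‖e‖ = 1) {a b : ℝ} (hb : b ≠ 0) (x : E N) :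
    inner ℂ e (anisoDilation e a b x) = a * inner ℂ e x := by
  rw [anisoDilation_apply hb, inner_add_right, inner_smul_right, inner_smul_right,
    inner_self_eq_norm_sq_to_K, he]
  push_cast
  ring

theorem norm_sq_anisoDilation {e : E N} (he : ‖e‖ = 1) {a b : ℝ} (hb : b ≠ 0) (x : E N) :
    ‖anisoDilation e a b x‖ ^ 2 =
      a ^ 2 * ‖(inner ℂ e x : ℂ)‖ ^ 2 + b ^ 2 * (‖x‖ ^ 2 - ‖(inner ℂ e x : ℂ)‖ ^ 2) := by
  rw [anisoDilation_apply hb, @norm_add_sq ℂ, inner_smul_left, inner_smul_right, norm_smul,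
    norm_smul, norm_mul, he, Complex.norm_real, Complex.norm_real, mul_one, mul_pow, mul_pow,
    Real.norm_eq_abs, Real.norm_eq_abs, sq_abs, sq_abs]
  have h : (inner ℂ e x : ℂ) * inner ℂ x e = ((‖(inner ℂ e x : ℂ)‖ ^ 2 : ℝ) : ℂ) := by
    rw [← inner_conj_symm x e, Complex.mul_conj, Complex.normSq_eq_norm_sq]
  have h2 : (starRingEnd ℂ) (b : ℂ) * ((((a - b : ℝ) : ℂ) * inner ℂ e x) * inner ℂ x e) =
      ((b * (a - b) * ‖(inner ℂ e x : ℂ)‖ ^ 2 : ℝ) : ℂ) := by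
    rw [mul_assoc, h, Complex.conj_ofReal]
    push_cast
    ring
  rw [h2, RCLike.re_eq_complex_re, Complex.ofReal_re]
  ring

theorem anisoDilation_anisoDilation_inv {e : E N} (he : ‖e‖ = 1) {a b : ℝ} (ha : a ≠ 0)
    (hb : b ≠ 0) (x : E N) : anisoDilation e a b (anisoDilation e a⁻¹ b⁻¹ x) = x := by
  have ha' : (a : ℂ) ≠ 0 := by exact_mod_cast ha
  have hb' : (b : ℂ) ≠ 0 := by exact_mod_cast hb
  rw [anisoDilation_apply hb, inner_anisoDilation he (inv_ne_zero hb),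
    anisoDilation_apply (inv_ne_zero hb), smul_add, smul_smul, smul_smul, add_assoc, ← add_smul]
  push_cast
  rw [mul_inv_cancel₀ hb', one_smul]
  convert add_zero x
  convert zero_smul ℂ e
  field_simp
  ring

theorem det_anisoDilation {e : E N} (he : ‖e‖ = 1) {a b : ℝ} :
    LinearMap.det (anisoDilation e a b) = ((b ^ N * (a / b) : ℝ) : ℂ) := by
  rw [anisoDilation, LinearMap.det_smul, LinearMap.transvection.det]
  simp [inner_self_eq_norm_sq_to_K, he]

theorem volume_image_anisoDilation {e : E N} (he : ‖e‖ = 1) {a b : ℝ}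
    (s : Set (E N)) :
    volume (anisoDilation e a b '' s) = ENNReal.ofReal ((b ^ N * (a / b)) ^ 2) * volume s := by
  have := Measure.addHaar_image_linearMap (μ := (volume : Measure (E N)))
    ((anisoDilation e a b).restrictScalars ℝ) s
  rw [LinearMap.det_restrictScalars, det_anisoDilation he, Algebra.norm_complex_apply,
    Complex.normSq_ofReal, ← pow_two, abs_of_nonneg (sq_nonneg _)] at this
  exact this

theorem volume_unitBall_pos (N : ℕ) : 0 < volume (unitBall N) :=
  Metric.measure_ball_pos _ _ one_pos

theorem volume_unitBall_lt_top (N : ℕ) : volume (unitBall N) < ∞ := measure_ball_lt_top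

theorem mem_unitBall {z : E N} : z ∈ unitBall N ↔ ‖z‖ < 1 := by simp [unitBall]

theorem mem_unitSphere {z : E N} : z ∈ unitSphere N ↔ ‖z‖ = 1 := by simp [unitSphere]

theorem isOpen_unitBall (N : ℕ) : IsOpen (unitBall N) := Metric.isOpen_ball

theorem measurableSet_unitBall (N : ℕ) : MeasurableSet (unitBall N) :=
  (isOpen_unitBall N).measurableSet

theorem exists_unit_smul_eq (hN : 1 ≤ N) (z : E N) :
    ∃ e : E N, ‖e‖ = 1 ∧ ((‖z‖ : ℝ) : ℂ) • e = z := by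
  by_cases hz : z = 0
  · refine ⟨EuclideanSpace.single ⟨0, hN⟩ 1, by simp, by simp [hz]⟩
  · have h : ‖z‖ ≠ 0 := norm_ne_zero_iff.2 hz
    have h' : ((‖z‖ : ℝ) : ℂ) ≠ 0 := by exact_mod_cast h
    refine ⟨((‖z‖ : ℝ) : ℂ)⁻¹ • z, ?_, ?_⟩
    · rw [norm_smul, norm_inv, Complex.norm_real, norm_norm, inv_mul_cancel₀ h]
    · rw [smul_smul, mul_inv_cancel₀ h', one_smul]

/-! ### Anisotropic neighbourhoods of the points of the ball -/

/-- The neighbourhood of `z` of size comparable with `1 - ‖z‖ ^ 2` in the direction of `z` and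
with its square root in the orthogonal directions. As a set of displacements `w - z` it is
invariant under multiplication by complex numbers of modulus one. -/
def adaptedNhd (z : E N) : Set (E N) :=
  {w | ‖(inner ℂ z (w - z) : ℂ)‖ < (1 - ‖z‖ ^ 2) / 8 ∧ ‖w - z‖ ^ 2 < (1 - ‖z‖ ^ 2) / 4}

theorem measurableSet_adaptedNhd_prod :
    MeasurableSet {p : E N × E N | p.2 ∈ adaptedNhd p.1} := by
  have h1 : IsOpen {p : E N × E N | ‖(inner ℂ p.1 (p.2 - p.1) : ℂ)‖ < (1 - ‖p.1‖ ^ 2) / 8} :=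
    isOpen_lt (by fun_prop) (by fun_prop)
  have h2 : IsOpen {p : E N × E N | ‖p.2 - p.1‖ ^ 2 < (1 - ‖p.1‖ ^ 2) / 4} :=
    isOpen_lt (by fun_prop) (by fun_prop)
  exact (h1.inter h2).measurableSet

theorem measurableSet_adaptedNhd (z : E N) : MeasurableSet (adaptedNhd z) :=
  measurableSet_adaptedNhd_prod.preimage (f := fun w : E N => (z, w)) (by fun_prop)

theorem abs_norm_sq_sub_of_mem_adaptedNhd {z w : E N} (hw : w ∈ adaptedNhd z) :
    |‖w‖ ^ 2 - ‖z‖ ^ 2| < (1 - ‖z‖ ^ 2) / 2 := by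
  obtain ⟨h1, h2⟩ := hw
  have h := @norm_add_sq ℂ _ _ _ _ z (w - z)
  rw [add_sub_cancel] at h
  have h3 := Complex.abs_re_le_norm (inner ℂ z (w - z))
  rw [RCLike.re_eq_complex_re] at h
  have h4 := abs_le.1 h3
  rw [abs_lt]
  constructor <;> nlinarith [sq_nonneg ‖w - z‖]

theorem adaptedNhd_subset_unitBall {z : E N} (hz : z ∈ unitBall N) :
    adaptedNhd z ⊆ unitBall N := by
  intro w hw
  have h := (abs_lt.1 (abs_norm_sq_sub_of_mem_adaptedNhd hw)).2
  rw [mem_unitBall] at hz ⊢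
  nlinarith [norm_nonneg z, norm_nonneg w]

theorem smul_mem_adaptedNhd {z s : E N} {c : ℂ} (hc : ‖c‖ ≤ 1) (hs : z + s ∈ adaptedNhd z) :
    z + c • s ∈ adaptedNhd z := by
  obtain ⟨h1, h2⟩ := hs
  rw [add_sub_cancel_left] at h1 h2
  refine ⟨?_, ?_⟩
  · rw [add_sub_cancel_left, inner_smul_right, norm_mul]
    exact (mul_le_of_le_one_left (norm_nonneg _) hc).trans_lt h1
  · rw [add_sub_cancel_left, norm_smul]
    refine lt_of_le_of_lt ?_ h2
    gcongr
    exact mul_le_of_le_one_left (norm_nonneg _) hc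

/-- The volume of the adapted neighbourhood of `z` is at least of order `(1 - ‖z‖²)^(N+1)`. -/
theorem volume_adaptedNhd_ge (hN : 1 ≤ N) {z : E N} (hz : z ∈ unitBall N) :
    ENNReal.ofReal ((1 - ‖z‖ ^ 2) ^ (N + 1) / (16 * 4 ^ N)) * volume (unitBall N) ≤
      volume (adaptedNhd z) := by
  obtain ⟨e, he, hez⟩ := exists_unit_smul_eq hN z
  set D := 1 - ‖z‖ ^ 2 with hD
  rw [mem_unitBall] at hz
  have hD0 : 0 < D := by nlinarith [norm_nonneg z]
  have hD1 : D ≤ 1 := by nlinarith [sq_nonneg ‖z‖]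
  have hb : 0 < √D / 2 := by positivity
  have hb2 : (√D / 2) ^ 2 = D / 4 := by rw [div_pow, Real.sq_sqrt hD0.le]; norm_num
  have hsub : (fun s => z + s) '' (anisoDilation e (D / 8) (√D / 2) '' unitBall N) ⊆
      adaptedNhd z := by
    rintro _ ⟨_, ⟨x, hx, rfl⟩, rfl⟩
    rw [mem_unitBall] at hx
    have hin : ‖(inner ℂ e x : ℂ)‖ ≤ ‖x‖ := by
      simpa [he] using norm_inner_le_norm (𝕜 := ℂ) e x
    refine ⟨?_, ?_⟩
    · dsimp only
      rw [add_sub_cancel_left]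
      nth_rw 1 [← hez]
      rw [inner_smul_left, inner_anisoDilation he hb.ne', norm_mul, norm_mul,
        Complex.norm_real, RCLike.norm_conj, Complex.norm_real, norm_norm, Real.norm_eq_abs,
        abs_of_pos (by positivity)]
      have : ‖z‖ * (D / 8 * ‖(inner ℂ e x : ℂ)‖) ≤ 1 * (D / 8 * ‖x‖) := by gcongr
      nlinarith
    · dsimp only
      rw [add_sub_cancel_left, norm_sq_anisoDilation he hb.ne', hb2]
      have h2 : ‖(inner ℂ e x : ℂ)‖ ^ 2 ≤ ‖x‖ ^ 2 := by gcongr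
      have h3 : ‖x‖ ^ 2 < 1 := by nlinarith [norm_nonneg x]
      have h4 : (D / 8) ^ 2 ≤ D / 4 := by nlinarith
      calc _ ≤ D / 4 * ‖(inner ℂ e x : ℂ)‖ ^ 2 + D / 4 * (‖x‖ ^ 2 - ‖(inner ℂ e x : ℂ)‖ ^ 2) := by
            gcongr
        _ = D / 4 * ‖x‖ ^ 2 := by ring
        _ < D / 4 := by nlinarith
  refine le_trans ?_ (measure_mono hsub)
  rw [image_add_left, measure_preimage_add, volume_image_anisoDilation he]
  gcongr
  have : ((√D / 2) ^ N * (D / 8 / (√D / 2))) ^ 2 = (D / 4) ^ N * ((D / 8) ^ 2 / (D / 4)) := by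
    rw [mul_pow, div_pow (D / 8), ← pow_mul, mul_comm N 2, pow_mul, hb2]
  rw [this, div_pow]
  apply le_of_eq
  field_simp
  ring

/-- The part of the ball near the point `e` of the sphere is contained in an anisotropic
box. -/
theorem volume_one_sub_inner_lt_le {e : E N} (he : ‖e‖ = 1) {t : ℝ} (ht : 0 < t) :
    volume {z : E N | ‖z‖ < 1 ∧ ‖1 - (inner ℂ e z : ℂ)‖ < t} ≤
      ENNReal.ofReal (t ^ (N + 1)) * volume (Metric.ball (0 : E N) 2) := by
  have hb : 0 < √t := by positivity
  have hsub : {z : E N | ‖z‖ < 1 ∧ ‖1 - (inner ℂ e z : ℂ)‖ < t} ⊆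
      (fun s => e + s) '' (anisoDilation e t (√t) '' Metric.ball (0 : E N) 2) := by
    rintro z ⟨hz, hzt⟩
    refine ⟨z - e, ⟨anisoDilation e t⁻¹ (√t)⁻¹ (z - e), ?_,
      anisoDilation_anisoDilation_inv he ht.ne' hb.ne' _⟩, by simp⟩
    rw [mem_ball_zero_iff, ← sq_lt_sq₀ (norm_nonneg _) two_pos.le,
      norm_sq_anisoDilation he (inv_ne_zero hb.ne'), inv_pow, inv_pow, Real.sq_sqrt ht.le]
    set u : ℂ := inner ℂ e z with hu
    have hi : (inner ℂ e (z - e) : ℂ) = u - 1 := by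
      rw [inner_sub_right, inner_self_eq_norm_sq_to_K, he]; simp [hu]
    have hu1 : ‖u‖ ≤ 1 := by
      have := norm_inner_le_norm (𝕜 := ℂ) e z
      rw [he, one_mul] at this
      exact this.trans hz.le
    have h1 : ‖z - e‖ ^ 2 - ‖u - 1‖ ^ 2 = ‖z‖ ^ 2 - ‖u‖ ^ 2 := by
      rw [@norm_sub_sq ℂ, @norm_sub_sq ℂ ℂ, ← inner_conj_symm, he, ← hu]
      simp
    have h2 : 1 - ‖u‖ ≤ ‖1 - u‖ := by simpa using norm_sub_norm_le 1 u
    rw [hi, h1, norm_sub_rev u 1]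
    have h3 : ‖z‖ ^ 2 - ‖u‖ ^ 2 ≤ 2 * t := by nlinarith [norm_nonneg z, norm_nonneg u]
    have h4 : ‖1 - u‖ ^ 2 ≤ t ^ 2 := by gcongr
    calc _ ≤ (t ^ 2)⁻¹ * t ^ 2 + t⁻¹ * (2 * t) := by gcongr
      _ = 3 := by field_simp; norm_num
      _ < 2 ^ 2 := by norm_num
  refine (measure_mono hsub).trans ?_
  rw [image_add_left, measure_preimage_add, volume_image_anisoDilation he]
  gcongr
  apply le_of_eq
  rw [mul_pow, div_pow, ← pow_mul, mul_comm N 2, pow_mul, Real.sq_sqrt ht.le]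
  field_simp
  ring

/-! ### The weighted volume near a boundary point -/

/-- Integration in polar coordinates of the product of a function of the direction and a radial
function. -/
theorem lintegral_polar (hN : 1 ≤ N) {u : E N → ℝ≥0∞} (hu : Measurable u) {w : ℝ → ℝ≥0∞}
    (hw : Measurable w) :
    ∫⁻ z : E N, u (‖z‖⁻¹ • z) * w ‖z‖ =
      (∫⁻ ζ, u ζ ∂(volume : Measure (E N)).toSphere) *
        ∫⁻ r in Ioi (0 : ℝ), ENNReal.ofReal (r ^ (2 * N - 1)) * w r := by
  have hN' : Nonempty (Fin N) := ⟨⟨0, hN⟩⟩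
  have hdim : Module.finrank ℝ (E N) = 2 * N := by
    rw [← Module.finrank_mul_finrank ℝ ℂ (E N), Complex.finrank_real_complex,
      finrank_euclideanSpace_fin]
  have hmp := (volume : Measure (E N)).measurePreserving_homeomorphUnitSphereProd
  rw [hdim] at hmp
  have h1 : ∫⁻ z : E N, u (‖z‖⁻¹ • z) * w ‖z‖ =
      ∫⁻ z in ({0}ᶜ : Set (E N)), u (‖z‖⁻¹ • z) * w ‖z‖ := by
    rw [restrict_compl_singleton]
  rw [h1, ← lintegral_subtype_comap (measurableSet_singleton _).compl]
  have h2 := hmp.lintegral_comp (f := fun p : Metric.sphere (0 : E N) 1 × Ioi (0 : ℝ) =>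
    u p.1 * w p.2) (by fun_prop)
  simp only [homeomorphUnitSphereProd_apply_fst_coe, homeomorphUnitSphereProd_apply_snd_coe] at h2
  rw [h2, lintegral_prod_mul (f := fun ζ : Metric.sphere (0 : E N) 1 => u ζ)
    (g := fun r : Ioi (0 : ℝ) => w r) (by fun_prop) (by fun_prop)]
  congr 1
  rw [Measure.volumeIoiPow, lintegral_withDensity_eq_lintegral_mul _ (by fun_prop) (by fun_prop),
    ← lintegral_subtype_comap measurableSet_Ioi]
  rfl

/-- The surface measure of a nonisotropic ball of radius `t` is at most of order `t ^ N`. The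
cone over the ball of height `t` has volume comparable with `t` times its surface measure, and it
is contained in an anisotropic box. -/
theorem exists_toSphere_le (hN : 1 ≤ N) : ∃ C : ℝ, 0 < C ∧ ∀ e : E N, ‖e‖ = 1 → ∀ t : ℝ, 0 < t →
    (volume : Measure (E N)).toSphere {ζ | ‖1 - (inner ℂ e ζ : ℂ)‖ < t} ≤
      ENNReal.ofReal (C * t ^ N) := by
  set σ := (volume : Measure (E N)).toSphere with hσ
  set V := (volume (Metric.ball (0 : E N) 2)).toReal with hV
  have hVe : volume (Metric.ball (0 : E N) 2) = ENNReal.ofReal V :=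
    (ENNReal.ofReal_toReal measure_ball_lt_top.ne).symm
  set S := (σ univ).toReal with hS
  have hSe : σ univ = ENNReal.ofReal S := (ENNReal.ofReal_toReal (measure_ne_top _ _)).symm
  have hV0 : 0 ≤ V := ENNReal.toReal_nonneg
  have hS0 : 0 ≤ S := ENNReal.toReal_nonneg
  refine ⟨S * 2 ^ N + V * 2 ^ (N + 1) * 2 ^ (2 * N - 1) + 1, by positivity, fun e he t ht => ?_⟩
  rcases le_or_gt t (1 / 2) with ht2 | ht2
  · set Q : Set (E N) := {ζ | ‖1 - (inner ℂ e ζ : ℂ)‖ < t} with hQ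
    have hQm : MeasurableSet Q := (isOpen_lt (by fun_prop) (by fun_prop)).measurableSet
    have hpol := lintegral_polar hN (u := Q.indicator 1)
      (w := (Ioo (1 - t) 1).indicator 1) (measurable_one.indicator hQm)
      (measurable_one.indicator measurableSet_Ioo)
    have hL : ∫⁻ z : E N, Q.indicator 1 (‖z‖⁻¹ • z) * (Ioo (1 - t) 1).indicator 1 ‖z‖ ≤
        ENNReal.ofReal ((2 * t) ^ (N + 1)) * volume (Metric.ball (0 : E N) 2) := by
      refine le_trans ?_ (volume_one_sub_inner_lt_le he (by positivity : 0 < 2 * t))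
      have hm : MeasurableSet {z : E N | ‖z‖ < 1 ∧ ‖1 - (inner ℂ e z : ℂ)‖ < 2 * t} :=
        MeasurableSet.inter (s₁ := {z : E N | ‖z‖ < 1})
          (s₂ := {z : E N | ‖1 - (inner ℂ e z : ℂ)‖ < 2 * t})
          (measurableSet_lt (by fun_prop) (by fun_prop))
          (measurableSet_lt (by fun_prop) (by fun_prop))
      rw [← lintegral_indicator_one hm]
      refine lintegral_mono fun z => ?_
      by_cases h1 : ‖z‖⁻¹ • z ∈ Q
      · by_cases h2 : ‖z‖ ∈ Ioo (1 - t) 1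
        · have hz0 : 0 < ‖z‖ := by linarith [h2.1]
          have hmem : ‖z‖ < 1 ∧ ‖1 - (inner ℂ e z : ℂ)‖ < 2 * t := by
            refine ⟨h2.2, ?_⟩
            have hin : (inner ℂ e z : ℂ) = ‖z‖ * inner ℂ e (‖z‖⁻¹ • z) := by
              rw [← Complex.coe_smul, inner_smul_right, ← mul_assoc, ← Complex.ofReal_mul,
                mul_inv_cancel₀ hz0.ne', Complex.ofReal_one, one_mul]
            have h1' : ‖1 - (inner ℂ e (‖z‖⁻¹ • z) : ℂ)‖ < t := h1
            calc ‖1 - (inner ℂ e z : ℂ)‖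
                = ‖((1 - ‖z‖ : ℝ) : ℂ) + ‖z‖ * (1 - inner ℂ e (‖z‖⁻¹ • z))‖ := by
                  rw [hin]; push_cast; congr 1; ring
              _ ≤ (1 - ‖z‖) + ‖z‖ * ‖1 - (inner ℂ e (‖z‖⁻¹ • z) : ℂ)‖ := by
                  refine (norm_add_le _ _).trans ?_
                  rw [Complex.norm_real, norm_mul, Complex.norm_real, norm_norm, Real.norm_eq_abs,
                    abs_of_pos (by linarith [h2.2])]
              _ < 2 * t := by nlinarith [h2.1, h2.2]
          rw [indicator_of_mem h1, indicator_of_mem h2, indicator_of_mem (by exact hmem)]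
          simp
        · simp [indicator_of_notMem h2]
      · simp [indicator_of_notMem h1]
    have hR : ENNReal.ofReal (t * (1 / 2) ^ (2 * N - 1)) ≤
        ∫⁻ r in Ioi (0 : ℝ), ENNReal.ofReal (r ^ (2 * N - 1)) * (Ioo (1 - t) 1).indicator 1 r := by
      calc ENNReal.ofReal (t * (1 / 2) ^ (2 * N - 1))
          = ∫⁻ r in Ioo (1 - t) 1, ENNReal.ofReal ((1 / 2) ^ (2 * N - 1)) := by
            rw [setLIntegral_const, Real.volume_Ioo, ← ENNReal.ofReal_mul (by positivity)]
            congr 1; ring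
        _ ≤ ∫⁻ r in Ioo (1 - t) 1, ENNReal.ofReal (r ^ (2 * N - 1)) := by
            refine setLIntegral_mono' measurableSet_Ioo fun r hr => ENNReal.ofReal_le_ofReal ?_
            gcongr
            linarith [hr.1]
        _ = ∫⁻ r in Ioi (0 : ℝ), (Ioo (1 - t) 1).indicator
              (fun r => ENNReal.ofReal (r ^ (2 * N - 1))) r := by
            rw [setLIntegral_indicator measurableSet_Ioo, inter_eq_left.2]
            intro r hr
            exact mem_Ioi.2 (by linarith [hr.1])
        _ ≤ _ := by
            refine lintegral_mono fun r => ?_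
            by_cases hr : r ∈ Ioo (1 - t) 1 <;> simp [hr]
    have hQσ : ∫⁻ ζ, Q.indicator 1 (ζ : E N) ∂σ = σ {ζ | ‖1 - (inner ℂ e ζ : ℂ)‖ < t} := by
      rw [← lintegral_indicator_one (by
        exact (isOpen_lt (by fun_prop) (by fun_prop)).measurableSet)]
      rfl
    rw [hQσ] at hpol
    have hfin : σ {ζ | ‖1 - (inner ℂ e ζ : ℂ)‖ < t} * ENNReal.ofReal (t * (1 / 2) ^ (2 * N - 1)) ≤
        ENNReal.ofReal ((2 * t) ^ (N + 1) * V) := by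
      rw [ENNReal.ofReal_mul (p := (2 * t) ^ (N + 1)) (by positivity), ← hVe]
      refine le_trans ?_ hL
      rw [hpol]
      gcongr
    have hpos : 0 < t * (1 / 2) ^ (2 * N - 1) := by positivity
    rw [← ENNReal.le_div_iff_mul_le (Or.inl (by simpa using hpos)) (Or.inl ENNReal.ofReal_ne_top),
      ← ENNReal.ofReal_div_of_pos hpos] at hfin
    refine hfin.trans (ENNReal.ofReal_le_ofReal ?_)
    have : (2 * t) ^ (N + 1) * V / (t * (1 / 2) ^ (2 * N - 1)) =
        V * 2 ^ (N + 1) * 2 ^ (2 * N - 1) * t ^ N := by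
      rw [one_div, inv_pow]
      field_simp
      ring
    rw [this]
    gcongr
    nlinarith [pow_pos (two_pos (α := ℝ)) N]
  · calc σ _ ≤ σ univ := measure_mono (subset_univ _)
      _ = ENNReal.ofReal S := hSe
      _ ≤ _ := by
        refine ENNReal.ofReal_le_ofReal ?_
        have h1 : 1 ≤ (2 * t) ^ N := one_le_pow₀ (by linarith)
        rw [mul_pow] at h1
        have h2 : 0 < t ^ N := by positivity
        have h3 : 0 ≤ (V * 2 ^ (N + 1) * 2 ^ (2 * N - 1) + 1) * t ^ N := by positivity
        nlinarith

/-- The normalizing factor that relates `v_α` to the density `(1 - |z|²)^α` with respect to the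
Lebesgue measure of the ball. -/
noncomputable def weightConst (N : ℕ) (α : ℝ) : ℝ :=
  ((volume (unitBall N)).toReal)⁻¹ *
    (Real.Gamma (N + α + 1) / ((N.factorial : ℝ) * Real.Gamma (α + 1)))

theorem weightConst_pos (N : ℕ) {α : ℝ} (hα : -1 < α) : 0 < weightConst N α := by
  have h1 : 0 < (volume (unitBall N)).toReal :=
    ENNReal.toReal_pos (volume_unitBall_pos N).ne' (volume_unitBall_lt_top N).ne
  have h2 := Real.Gamma_pos_of_pos (show 0 < (N : ℝ) + α + 1 by
    have := N.cast_nonneg (α := ℝ); linarith)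
  have h3 := Real.Gamma_pos_of_pos (show 0 < α + 1 by linarith)
  unfold weightConst
  positivity

theorem lintegral_weightedVolume {α : ℝ} (hα : -1 < α) {F : E N → ℝ≥0∞} (hF : Measurable F) :
    ∫⁻ z, F z ∂(weightedVolume N α) =
      ENNReal.ofReal (weightConst N α) *
        ∫⁻ z in unitBall N, ENNReal.ofReal ((1 - ‖z‖ ^ 2) ^ α) * F z := by
  have h1 : 0 < (volume (unitBall N)).toReal :=
    ENNReal.toReal_pos (volume_unitBall_pos N).ne' (volume_unitBall_lt_top N).ne
  have h2 := Real.Gamma_pos_of_pos (show 0 < (N : ℝ) + α + 1 by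
    have := N.cast_nonneg (α := ℝ); linarith)
  have h3 := Real.Gamma_pos_of_pos (show 0 < α + 1 by linarith)
  rw [weightedVolume, lintegral_withDensity_eq_lintegral_mul _ (by fun_prop) hF, normalizedVolume,
    lintegral_smul_measure, weightConst, ENNReal.ofReal_mul (by positivity),
    ENNReal.ofReal_inv_of_pos h1, ENNReal.ofReal_toReal (volume_unitBall_lt_top N).ne, mul_assoc,
    smul_eq_mul]
  congr 1
  rw [← lintegral_const_mul' _ _ ENNReal.ofReal_ne_top]
  refine lintegral_congr fun z => ?_
  rw [Pi.mul_apply, ENNReal.ofReal_mul (by positivity), mul_assoc]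

theorem weightedVolume_compl_unitBall (α : ℝ) : weightedVolume N α (unitBall N)ᶜ = 0 := by
  refine withDensity_absolutelyContinuous _ _ ?_
  rw [normalizedVolume, Measure.smul_apply, Measure.restrict_apply (measurableSet_unitBall N).compl]
  simp

/-- On `[0, 1)` the weight `(1 - r²)^α` is at most of order `(1 - r)^α`. -/
theorem one_sub_sq_rpow_le {α r : ℝ} (hr0 : 0 ≤ r) (hr1 : r < 1) :
    (1 - r ^ 2) ^ α ≤ 2 ^ |α| * (1 - r) ^ α := by
  rw [show 1 - r ^ 2 = (1 + r) * (1 - r) by ring, Real.mul_rpow (by linarith) (by linarith)]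
  refine mul_le_mul_of_nonneg_right ?_ (Real.rpow_nonneg (by linarith) _)
  calc (1 + r) ^ α ≤ (1 + r) ^ |α| :=
        Real.rpow_le_rpow_of_exponent_le (by linarith) (le_abs_self α)
    _ ≤ 2 ^ |α| := Real.rpow_le_rpow (by linarith) (by linarith) (abs_nonneg α)

theorem lintegral_one_sub_rpow {α : ℝ} (hα : -1 < α) {t : ℝ} (ht : 0 < t) :
    ∫⁻ r in Ioo (1 - t) 1, ENNReal.ofReal ((1 - r) ^ α) =
      ENNReal.ofReal (t ^ (α + 1) / (α + 1)) := by
  have hint : IntervalIntegrable (fun r : ℝ => (1 - r) ^ α) volume (1 - t) 1 := by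
    have := (intervalIntegral.intervalIntegrable_rpow' (a := t) (b := 0) hα).comp_sub_left 1
    simpa using this
  rw [Measure.restrict_congr_set Ioo_ae_eq_Ioc, ← ofReal_integral_eq_lintegral_ofReal hint.1,
    ← intervalIntegral.integral_of_le (by linarith)]
  · rw [intervalIntegral.integral_comp_sub_left (fun x : ℝ => x ^ α) 1]
    simp [integral_rpow (Or.inl hα), Real.zero_rpow (by linarith : α + 1 ≠ 0)]
  · filter_upwards [ae_restrict_mem measurableSet_Ioc] with r hr
    exact Real.rpow_nonneg (by linarith [hr.2]) _

/-- The `v_α`-measure of the part of the ball at nonisotropic distance less than `√t` from a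
boundary point is at most of order `t^(N+1+α)`. -/
theorem exists_weightedVolume_le (hN : 1 ≤ N) {α : ℝ} (hα : -1 < α) : ∃ C : ℝ, 0 < C ∧
    ∀ e : E N, ‖e‖ = 1 → ∀ t : ℝ, 0 < t →
      weightedVolume N α {z | ‖1 - (inner ℂ e z : ℂ)‖ < t} ≤
        ENNReal.ofReal (C * t ^ ((N : ℝ) + 1 + α)) := by
  obtain ⟨C, hC, hσ⟩ := exists_toSphere_le hN
  have hw := weightConst_pos N hα
  have hα1 : 0 < α + 1 := by linarith
  refine ⟨weightConst N α * ((C * 2 ^ N) * (2 ^ |α| / (α + 1))), by positivity, fun e he t ht => ?_⟩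
  set U : Set (E N) := {z | ‖1 - (inner ℂ e z : ℂ)‖ < t} with hU
  have hUm : MeasurableSet U := (isOpen_lt (by fun_prop) (by fun_prop)).measurableSet
  set Q : Set (E N) := {ζ | ‖1 - (inner ℂ e ζ : ℂ)‖ < 2 * t} with hQ
  have hQm : MeasurableSet Q := (isOpen_lt (by fun_prop) (by fun_prop)).measurableSet
  set w : ℝ → ℝ≥0∞ := (Ioo (1 - t) 1).indicator fun r => ENNReal.ofReal ((1 - r ^ 2) ^ α) with hwdef
  have hwm : Measurable w := Measurable.indicator (by fun_prop) measurableSet_Ioo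
  rw [← lintegral_indicator_one hUm, lintegral_weightedVolume hα (measurable_one.indicator hUm),
    mul_assoc, ENNReal.ofReal_mul hw.le]
  gcongr
  calc ∫⁻ z in unitBall N, ENNReal.ofReal ((1 - ‖z‖ ^ 2) ^ α) * U.indicator 1 z
      ≤ ∫⁻ z : E N, Q.indicator 1 (‖z‖⁻¹ • z) * w ‖z‖ := by
        rw [← lintegral_indicator (measurableSet_unitBall N)]
        have hne : ∀ᵐ z : E N, z ≠ 0 := by
          have hN' : Nonempty (Fin N) := ⟨⟨0, hN⟩⟩
          simp [ae_iff]
        refine lintegral_mono_ae ?_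
        filter_upwards [hne] with z hz
        by_cases hzB : z ∈ unitBall N
        · by_cases hzU : z ∈ U
          · have hz0 : 0 < ‖z‖ := norm_pos_iff.2 hz
            have hz1 : ‖z‖ < 1 := mem_unitBall.1 hzB
            have hu : ‖(inner ℂ e z : ℂ)‖ ≤ ‖z‖ := by
              simpa [he] using norm_inner_le_norm (𝕜 := ℂ) e z
            have hzU' : ‖1 - (inner ℂ e z : ℂ)‖ < t := hzU
            have h1 : 1 - ‖z‖ < t := by
              have : 1 - ‖(inner ℂ e z : ℂ)‖ ≤ ‖1 - (inner ℂ e z : ℂ)‖ := by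
                simpa using norm_sub_norm_le 1 (inner ℂ e z : ℂ)
              linarith
            have h2 : ‖z‖ ∈ Ioo (1 - t) 1 := ⟨by linarith, hz1⟩
            have h3 : ‖z‖⁻¹ • z ∈ Q := by
              have hin : (inner ℂ e (‖z‖⁻¹ • z) : ℂ) = inner ℂ e z +
                  ((‖z‖⁻¹ - 1 : ℝ) : ℂ) * inner ℂ e z := by
                rw [← Complex.coe_smul, inner_smul_right]
                push_cast; ring
              change ‖1 - (inner ℂ e (‖z‖⁻¹ • z) : ℂ)‖ < 2 * t
              rw [hin, ← sub_sub]
              refine (norm_sub_le _ _).trans_lt ?_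
              have h4 : 0 ≤ ‖z‖⁻¹ - 1 := by
                rw [sub_nonneg]; exact (one_le_inv₀ hz0).2 hz1.le
              rw [norm_mul, Complex.norm_real, Real.norm_eq_abs, abs_of_nonneg h4]
              have h5 : (‖z‖⁻¹ - 1) * ‖(inner ℂ e z : ℂ)‖ ≤ (‖z‖⁻¹ - 1) * ‖z‖ := by gcongr
              have h6 : (‖z‖⁻¹ - 1) * ‖z‖ = 1 - ‖z‖ := by field_simp
              linarith
            rw [indicator_of_mem hzB, indicator_of_mem hzU, indicator_of_mem h3, hwdef,
              indicator_of_mem h2]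
            simp
          · rw [indicator_of_mem hzB, indicator_of_notMem hzU, mul_zero]; exact zero_le
        · rw [indicator_of_notMem hzB]; exact zero_le
    _ = (∫⁻ ζ, Q.indicator 1 (ζ : E N) ∂(volume : Measure (E N)).toSphere) *
        ∫⁻ r in Ioi (0 : ℝ), ENNReal.ofReal (r ^ (2 * N - 1)) * w r :=
        lintegral_polar hN (measurable_one.indicator hQm) hwm
    _ ≤ ENNReal.ofReal (C * (2 * t) ^ N) * ENNReal.ofReal (2 ^ |α| * (t ^ (α + 1) / (α + 1))) := by
        gcongr
        · refine le_trans (le_of_eq ?_) (hσ e he (2 * t) (by positivity))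
          rw [← lintegral_indicator_one (by
            exact (isOpen_lt (by fun_prop) (by fun_prop)).measurableSet)]
          rfl
        · rw [ENNReal.ofReal_mul (by positivity), ← lintegral_one_sub_rpow hα ht,
            ← lintegral_const_mul' _ _ ENNReal.ofReal_ne_top,
            ← lintegral_indicator measurableSet_Ioi,
            ← lintegral_indicator measurableSet_Ioo]
          refine lintegral_mono fun r => ?_
          by_cases h0 : r ∈ Ioi (0 : ℝ)
          · by_cases h1 : r ∈ Ioo (1 - t) 1
            · rw [indicator_of_mem h0, indicator_of_mem h1, hwdef, indicator_of_mem h1]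
              have h0' : 0 < r := h0
              rw [← ENNReal.ofReal_mul (pow_nonneg h0'.le _), ← ENNReal.ofReal_mul (by positivity)]
              refine ENNReal.ofReal_le_ofReal ?_
              have h2 := one_sub_sq_rpow_le (α := α) h0'.le h1.2
              have h3 : r ^ (2 * N - 1) ≤ 1 := pow_le_one₀ h0'.le h1.2.le
              have h4 : 0 ≤ (1 - r ^ 2) ^ α := Real.rpow_nonneg (by nlinarith [h1.2]) _
              exact (mul_le_of_le_one_left h4 h3).trans h2
            · simp [hwdef, h1]
          · simp only [indicator_of_notMem h0]; exact zero_le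
    _ = ENNReal.ofReal (C * 2 ^ N * (2 ^ |α| / (α + 1)) * t ^ ((N : ℝ) + 1 + α)) := by
        rw [← ENNReal.ofReal_mul (by positivity)]
        congr 1
        rw [show (N : ℝ) + 1 + α = N + (α + 1) by ring, Real.rpow_add ht N, Real.rpow_natCast]
        ring

theorem isFiniteMeasure_weightedVolume (hN : 1 ≤ N) {α : ℝ} (hα : -1 < α) :
    IsFiniteMeasure (weightedVolume N α) := by
  obtain ⟨C, -, h⟩ := exists_weightedVolume_le hN hα
  obtain ⟨e, he, -⟩ := exists_unit_smul_eq hN 0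
  refine ⟨?_⟩
  have hcov : (univ : Set (E N)) ⊆ (unitBall N)ᶜ ∪ {z | ‖1 - (inner ℂ e z : ℂ)‖ < 3} := by
    intro z _
    by_cases hz : z ∈ unitBall N
    · right
      have h1 : ‖(inner ℂ e z : ℂ)‖ ≤ ‖z‖ := by
        simpa [he] using norm_inner_le_norm (𝕜 := ℂ) e z
      have h2 := norm_sub_le (1 : ℂ) (inner ℂ e z)
      rw [norm_one] at h2
      have h3 := mem_unitBall.1 hz
      exact (h2.trans_lt (by linarith) : ‖1 - (inner ℂ e z : ℂ)‖ < 3)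
    · exact Or.inl hz
  refine (measure_mono hcov).trans_lt ((measure_union_le _ _).trans_lt ?_)
  rw [weightedVolume_compl_unitBall, zero_add]
  exact (h e he 3 (by norm_num)).trans_lt ENNReal.ofReal_lt_top

/-! ### The sub-mean value inequality -/

theorem IsOrlicz.convexOn_norm_div {ψ : ℝ → ℝ} (h : IsOrlicz ψ) {C : ℝ} (hC : 0 < C) :
    ConvexOn ℝ univ fun x : ℂ => ψ (‖x‖ / C) := by
  refine ⟨convex_univ, fun x _ y _ a b ha hb hab => ?_⟩
  calc ψ (‖a • x + b • y‖ / C) ≤ ψ (a * (‖x‖ / C) + b * (‖y‖ / C)) := by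
        refine h.mono (by positivity) ?_
        rw [← mul_div_assoc, ← mul_div_assoc, ← add_div]
        gcongr
        refine (norm_add_le _ _).trans ?_
        rw [norm_smul, norm_smul, Real.norm_of_nonneg ha, Real.norm_of_nonneg hb]
    _ ≤ _ := h.convexOn.2 (mem_Ici.2 (by positivity)) (mem_Ici.2 (by positivity)) ha hb hab

/-- Convex functions of holomorphic functions satisfy the sub-mean value inequality on circles. -/
theorem map_mul_le_lintegral_circleMap {Ψ : ℂ → ℝ} (hΨ : ConvexOn ℝ univ Ψ) (hΨc : Continuous Ψ)
    (hΨ0 : ∀ x, 0 ≤ Ψ x) {φ : ℂ → ℂ} (hφ : DifferentiableOn ℂ φ (Metric.closedBall 0 1)) :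
    ENNReal.ofReal (2 * Real.pi) * ENNReal.ofReal (Ψ (φ 0)) ≤
      ∫⁻ θ in Ioc 0 (2 * Real.pi), ENNReal.ofReal (Ψ (φ (circleMap 0 1 θ))) := by
  have hpi : 0 < 2 * Real.pi := Real.two_pi_pos
  have hc : Continuous fun θ => φ (circleMap 0 1 θ) :=
    hφ.continuousOn.comp_continuous (continuous_circleMap 0 1) fun θ => by
      simp [circleMap]
  have hmean : φ 0 = ⨍ θ in Ioc 0 (2 * Real.pi), φ (circleMap 0 1 θ) := by
    have h1 : DiffContOnCl ℂ φ (Metric.ball 0 |1|) := by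
      refine DifferentiableOn.diffContOnCl ?_
      rwa [abs_one, closure_ball _ one_ne_zero]
    rw [← h1.circleAverage, Real.circleAverage_def, setAverage_eq,
      intervalIntegral.integral_of_le hpi.le]
    rw [Real.volume_real_Ioc_of_le hpi.le, sub_zero]
  have hfin : IsFiniteMeasure (volume.restrict (Ioc 0 (2 * Real.pi))) := ⟨by
    rw [Measure.restrict_apply_univ]; exact measure_Ioc_lt_top⟩
  have hne : NeZero (volume.restrict (Ioc 0 (2 * Real.pi))) := ⟨by
    simp [Measure.restrict_eq_zero, Real.pi_pos]⟩
  have hint : ∀ {F : Type} [NormedAddCommGroup F] {u : ℝ → F}, Continuous u →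
      Integrable u (volume.restrict (Ioc 0 (2 * Real.pi))) := fun hu =>
    (hu.integrableOn_Icc (a := 0) (b := 2 * Real.pi)).mono_set Ioc_subset_Icc_self
  have hJ := hΨ.map_average_le (μ := volume.restrict (Ioc 0 (2 * Real.pi)))
    (f := fun θ => φ (circleMap 0 1 θ)) hΨc.continuousOn isClosed_univ (by simp) (hint hc)
    (hint (hΨc.comp hc))
  have hΨφ : Continuous fun θ => Ψ (φ (circleMap 0 1 θ)) := hΨc.comp hc
  rw [← hmean, setAverage_eq] at hJ
  rw [← ofReal_integral_eq_lintegral_ofReal (hint hΨφ) (ae_of_all _ fun _ => hΨ0 _),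
    ← ENNReal.ofReal_mul hpi.le]
  refine ENNReal.ofReal_le_ofReal ?_
  rw [Real.volume_real_Ioc_of_le hpi.le, sub_zero, smul_eq_mul] at hJ
  calc 2 * Real.pi * Ψ (φ 0) ≤ 2 * Real.pi * ((2 * Real.pi)⁻¹ *
        ∫ θ in Ioc 0 (2 * Real.pi), Ψ (φ (circleMap 0 1 θ))) := by gcongr
    _ = _ := by rw [← mul_assoc, mul_inv_cancel₀ hpi.ne', one_mul]

/-- Rotation by a complex number of modulus one preserves the Lebesgue measure. -/
theorem lintegral_smul_circle {F : E N → ℝ≥0∞} (c : Circle) :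
    ∫⁻ s, F ((c : ℂ) • s) = ∫⁻ s, F s := by
  let L : E N ≃ₗᵢ[ℝ] E N :=
    { (LinearEquiv.smulOfUnit (Units.mk0 (c : ℂ) c.coe_ne_zero) :
        E N ≃ₗ[ℂ] E N).restrictScalars ℝ with
      norm_map' := fun x => by
        change ‖(c : ℂ) • x‖ = ‖x‖
        rw [norm_smul, Circle.norm_coe, one_mul] }
  exact L.measurePreserving.lintegral_comp_emb L.toMeasurableEquiv.measurableEmbedding F

theorem smul_mem_adaptedNhd_iff {z s : E N} (c : Circle) :
    z + (c : ℂ) • s ∈ adaptedNhd z ↔ z + s ∈ adaptedNhd z := by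
  refine ⟨fun h => ?_, smul_mem_adaptedNhd (Circle.norm_coe c).le⟩
  have := smul_mem_adaptedNhd (c := ((c⁻¹ : Circle) : ℂ)) (Circle.norm_coe _).le h
  rwa [smul_smul, ← Circle.coe_mul, inv_mul_cancel, Circle.coe_one, one_smul] at this

/-- The mean over an adapted neighbourhood dominates the value at its centre: the set of
displacements is circled, so it can be averaged over rotations, which leaves circle means. -/
theorem volume_adaptedNhd_mul_le {Ψ : ℂ → ℝ} (hΨ : ConvexOn ℝ univ Ψ) (hΨc : Continuous Ψ)
    (hΨ0 : ∀ x, 0 ≤ Ψ x) {f : E N → ℂ} (hfm : Measurable f)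
    (hf : DifferentiableOn ℂ f (unitBall N)) {z : E N} (hz : z ∈ unitBall N) :
    volume (adaptedNhd z) * ENNReal.ofReal (Ψ (f z)) ≤
      ∫⁻ w in adaptedNhd z, ENNReal.ofReal (Ψ (f w)) := by
  set S : Set (E N) := {s | z + s ∈ adaptedNhd z} with hS
  have hSm : MeasurableSet S := (measurableSet_adaptedNhd z).preimage (by fun_prop)
  set G : E N → ℝ≥0∞ := fun w => ENNReal.ofReal (Ψ (f w)) with hG
  have hGm : Measurable G := (hΨc.measurable.comp hfm).ennreal_ofReal
  have hvol : volume S = volume (adaptedNhd z) := measure_preimage_add volume z (adaptedNhd z)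
  have hI : ∫⁻ w in adaptedNhd z, G w = ∫⁻ s, S.indicator (fun s => G (z + s)) s := by
    rw [← lintegral_indicator (measurableSet_adaptedNhd z),
      ← lintegral_add_left_eq_self _ z]
    rfl
  have hrot : ∀ θ : ℝ, ∫⁻ s, S.indicator (fun s => G (z + circleMap 0 1 θ • s)) s =
      ∫⁻ w in adaptedNhd z, G w := by
    intro θ
    rw [hI]
    refine Eq.trans ?_ (lintegral_smul_circle (F := S.indicator fun s => G (z + s)) (Circle.exp θ))
    refine lintegral_congr fun s => ?_
    have hc : circleMap 0 1 θ = (Circle.exp θ : ℂ) := by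
      rw [Circle.coe_exp, circleMap_zero, Complex.ofReal_one, one_mul]
    have hmem : (Circle.exp θ : ℂ) • s ∈ S ↔ s ∈ S := by
      simp only [hS, mem_ofPred_eq]
      exact smul_mem_adaptedNhd_iff (z := z) (s := s) (Circle.exp θ)
    rw [hc]
    by_cases h : s ∈ S
    · rw [indicator_of_mem h, indicator_of_mem (hmem.2 h)]
    · rw [indicator_of_notMem h, indicator_of_notMem (fun h' => h (hmem.1 h'))]
  have hpi : 0 < 2 * Real.pi := Real.two_pi_pos
  have hpi' : ENNReal.ofReal (2 * Real.pi) ≠ 0 := by simpa using hpi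
  rw [← ENNReal.mul_le_mul_iff_right hpi' ENNReal.ofReal_ne_top]
  calc ENNReal.ofReal (2 * Real.pi) * (volume (adaptedNhd z) * G z)
      = ∫⁻ s, S.indicator (fun _ => ENNReal.ofReal (2 * Real.pi) * G z) s := by
        rw [lintegral_indicator_const hSm, hvol]; ring
    _ ≤ ∫⁻ s, ∫⁻ θ in Ioc 0 (2 * Real.pi),
          S.indicator (fun s => G (z + circleMap 0 1 θ • s)) s := by
        refine lintegral_mono fun s => ?_
        by_cases hs : s ∈ S
        · simp only [indicator_of_mem hs]
          have hd : DifferentiableOn ℂ (fun c : ℂ => f (z + c • s)) (Metric.closedBall 0 1) := by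
            refine hf.comp (by fun_prop) fun c hc => ?_
            exact adaptedNhd_subset_unitBall hz
              (smul_mem_adaptedNhd (by simpa using hc) hs)
          simpa using map_mul_le_lintegral_circleMap hΨ hΨc hΨ0 hd
        · simp [hs]
    _ = ∫⁻ θ in Ioc 0 (2 * Real.pi), ∫⁻ s,
          S.indicator (fun s => G (z + circleMap 0 1 θ • s)) s := by
        refine lintegral_lintegral_swap (Measurable.aemeasurable ?_)
        have h1 : Measurable fun p : E N × ℝ => G (z + circleMap 0 1 p.2 • p.1) := by
          have : Measurable fun p : E N × ℝ => z + circleMap 0 1 p.2 • p.1 :=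
            Continuous.measurable (by fun_prop)
          exact hGm.comp this
        exact h1.indicator (hSm.preimage measurable_fst)
    _ = ENNReal.ofReal (2 * Real.pi) * ∫⁻ w in adaptedNhd z, G w := by
        simp_rw [hrot]
        rw [setLIntegral_const, Real.volume_Ioc, sub_zero, mul_comm]

theorem two_rpow_neg_abs_le {r α : ℝ} (h1 : 1 / 2 ≤ r) (h2 : r ≤ 2) : 2 ^ (-|α|) ≤ r ^ α := by
  rcases le_total 1 r with hr | hr
  · calc (2 : ℝ) ^ (-|α|) ≤ r ^ (-|α|) :=
          Real.rpow_le_rpow_of_nonpos (by linarith) h2 (by simp)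
      _ ≤ r ^ α := Real.rpow_le_rpow_of_exponent_le hr (neg_abs_le α)
  · calc (2 : ℝ) ^ (-|α|) = (1 / 2) ^ |α| := by
          rw [one_div, Real.inv_rpow two_pos.le, Real.rpow_neg two_pos.le]
      _ ≤ r ^ |α| := Real.rpow_le_rpow (by norm_num) h1 (abs_nonneg _)
      _ ≤ r ^ α := Real.rpow_le_rpow_of_exponent_ge (by linarith) hr (le_abs_self α)

/-- The weighted sub-mean value inequality over adapted neighbourhoods, with a constant outside
and none inside the Orlicz function. -/
theorem exists_submean (hN : 1 ≤ N) {α : ℝ} (hα : -1 < α) : ∃ C₁ : ℝ, 1 ≤ C₁ ∧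
    ∀ {ψ : ℝ → ℝ}, IsOrlicz ψ → ∀ {f : E N → ℂ}, Measurable f → DifferentiableOn ℂ f (unitBall N) →
    ∀ {C : ℝ}, 0 < C → ∀ {z : E N}, z ∈ unitBall N →
      ENNReal.ofReal (ψ (‖f z‖ / C)) ≤
        ENNReal.ofReal (C₁ * (1 - ‖z‖ ^ 2) ^ (-((N : ℝ) + 1 + α))) *
          ∫⁻ w in adaptedNhd z, ENNReal.ofReal (ψ (‖f w‖ / C)) ∂(weightedVolume N α) := by
  have hk := weightConst_pos N hα
  set V := (volume (unitBall N)).toReal with hV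
  have hV0 : 0 < V := ENNReal.toReal_pos (volume_unitBall_pos N).ne' (volume_unitBall_lt_top N).ne
  have hVe : volume (unitBall N) = ENNReal.ofReal V :=
    (ENNReal.ofReal_toReal (volume_unitBall_lt_top N).ne).symm
  set c : ℝ := weightConst N α * 2 ^ (-|α|) * (V / (16 * 4 ^ N)) with hc
  have hc0 : 0 < c := by positivity
  refine ⟨max 1 c⁻¹, le_max_left _ _, fun {ψ} h {f} hfm hf {C} hC {z} hz => ?_⟩
  set D := 1 - ‖z‖ ^ 2 with hD
  have hD0 : 0 < D := by
    have := mem_unitBall.1 hz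
    nlinarith [norm_nonneg z]
  set S := adaptedNhd z with hS
  have hSm : MeasurableSet S := measurableSet_adaptedNhd z
  set G : E N → ℝ≥0∞ := fun w => ENNReal.ofReal (ψ (‖f w‖ / C)) with hG
  have hGm : Measurable G := ((h.continuous_norm_div hC.le).measurable.comp hfm).ennreal_ofReal
  have hmean : volume S * G z ≤ ∫⁻ w in S, G w :=
    volume_adaptedNhd_mul_le (h.convexOn_norm_div hC) (h.continuous_norm_div hC.le)
      (fun x => h.nonneg _ (by positivity)) hfm hf hz
  have hkey : ENNReal.ofReal (c * D ^ ((N : ℝ) + 1 + α)) * G z ≤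
      ∫⁻ w in S, G w ∂(weightedVolume N α) := by
    calc ENNReal.ofReal (c * D ^ ((N : ℝ) + 1 + α)) * G z
        = ENNReal.ofReal (weightConst N α) * (ENNReal.ofReal (2 ^ (-|α|) * D ^ α) *
            ((ENNReal.ofReal (D ^ (N + 1) / (16 * 4 ^ N)) * volume (unitBall N)) * G z)) := by
          have : c * D ^ ((N : ℝ) + 1 + α) = weightConst N α * ((2 ^ (-|α|) * D ^ α) *
              (D ^ (N + 1) / (16 * 4 ^ N) * V)) := by
            rw [show (N : ℝ) + 1 + α = ((N + 1 : ℕ) : ℝ) + α by push_cast; ring,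
              Real.rpow_add hD0, Real.rpow_natCast, hc]
            ring
          rw [this, ENNReal.ofReal_mul hk.le, ENNReal.ofReal_mul (by positivity),
            ENNReal.ofReal_mul (p := D ^ (N + 1) / (16 * 4 ^ N)) (by positivity), hVe]
          simp only [mul_assoc]
      _ ≤ ENNReal.ofReal (weightConst N α) * (ENNReal.ofReal (2 ^ (-|α|) * D ^ α) *
            ∫⁻ w in S, G w) := by
          gcongr
          exact (mul_le_mul_left (volume_adaptedNhd_ge hN hz) _).trans hmean
      _ = ENNReal.ofReal (weightConst N α) * (
            ∫⁻ w in S, ENNReal.ofReal (2 ^ (-|α|) * D ^ α) * G w) := by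
          rw [lintegral_const_mul _ hGm]
      _ ≤ ENNReal.ofReal (weightConst N α) * (
            ∫⁻ w in S, ENNReal.ofReal ((1 - ‖w‖ ^ 2) ^ α) * G w) := by
          refine mul_le_mul_right (setLIntegral_mono' hSm fun w hw => ?_) _
          gcongr
          have hw' := abs_lt.1 (abs_norm_sq_sub_of_mem_adaptedNhd hw)
          have h1 : 1 / 2 ≤ (1 - ‖w‖ ^ 2) / D := by rw [le_div_iff₀ hD0]; linarith
          have h2 : (1 - ‖w‖ ^ 2) / D ≤ 2 := by rw [div_le_iff₀ hD0]; linarith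
          have h3 := two_rpow_neg_abs_le (α := α) h1 h2
          rw [Real.div_rpow (by linarith) hD0.le] at h3
          rwa [le_div_iff₀ (by positivity)] at h3
      _ = ENNReal.ofReal (weightConst N α) * (
            ∫⁻ w in unitBall N, ENNReal.ofReal ((1 - ‖w‖ ^ 2) ^ α) * S.indicator G w) := by
          congr 1
          have : ∀ w, ENNReal.ofReal ((1 - ‖w‖ ^ 2) ^ α) * S.indicator G w =
              S.indicator (fun w => ENNReal.ofReal ((1 - ‖w‖ ^ 2) ^ α) * G w) w := fun w => by
            by_cases hw : w ∈ S <;> simp [hw]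
          simp_rw [this]
          rw [setLIntegral_indicator hSm, inter_eq_left.2 (adaptedNhd_subset_unitBall hz)]
      _ = ∫⁻ w in S, G w ∂(weightedVolume N α) := by
          rw [← lintegral_weightedVolume hα (hGm.indicator hSm), lintegral_indicator hSm]
  calc G z = ENNReal.ofReal (c⁻¹ * D ^ (-((N : ℝ) + 1 + α))) *
        (ENNReal.ofReal (c * D ^ ((N : ℝ) + 1 + α)) * G z) := by
        rw [← mul_assoc, ← ENNReal.ofReal_mul (by positivity), Real.rpow_neg hD0.le]
        have h0 : D ^ ((N : ℝ) + 1 + α) ≠ 0 := by positivity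
        rw [show c⁻¹ * (D ^ ((N : ℝ) + 1 + α))⁻¹ * (c * D ^ ((N : ℝ) + 1 + α)) = 1 by field_simp]
        simp
    _ ≤ _ := by
        gcongr
        exact le_max_right _ _

/-! ### Carleson windows and the uniform tail estimate -/

theorem mem_carlesonWindow {ζ z : E N} {h : ℝ} :
    z ∈ carlesonWindow ζ h ↔ ‖z‖ < 1 ∧ 1 - ‖z‖ < h ∧ ‖(((‖z‖⁻¹ : ℝ) : ℂ) • z)‖ = 1 ∧
      ‖1 - (inner ℂ (((‖z‖⁻¹ : ℝ) : ℂ) • z) ζ : ℂ)‖ < h := by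
  have : ∀ ξ : E N, nonisoDist ζ ξ ^ 2 = ‖1 - (inner ℂ ξ ζ : ℂ)‖ := fun ξ =>
    Real.sq_sqrt (norm_nonneg _)
  rw [← this, ← mem_unitBall, ← mem_unitSphere]
  rfl

theorem measure_carlesonWindow_le_rho (μ : Measure (E N)) {ζ : E N} (hζ : ‖ζ‖ = 1) (h : ℝ) :
    μ (carlesonWindow ζ h) ≤ rho μ h :=
  le_iSup₂ (f := fun ξ (_ : ξ ∈ unitSphere N) => μ (carlesonWindow ξ h)) ζ (mem_unitSphere.2 hζ)

/-- A point whose adapted neighbourhood contains `w` lies in a window of size comparable with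
`1 - ‖w‖ ^ 2` around the radial projection of `w`. -/
theorem mem_carlesonWindow_of_mem_adaptedNhd {z w : E N} (hz : z ∈ unitBall N)
    (hz2 : 1 - ‖z‖ ^ 2 ≤ 1 / 2) (hw : w ∈ adaptedNhd z) :
    ‖(((‖w‖⁻¹ : ℝ) : ℂ) • w)‖ = 1 ∧
      z ∈ carlesonWindow (((‖w‖⁻¹ : ℝ) : ℂ) • w) (8 * (1 - ‖w‖ ^ 2)) := by
  have hz1 := mem_unitBall.1 hz
  have hw1 := mem_unitBall.1 (adaptedNhd_subset_unitBall hz hw)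
  have hD := abs_lt.1 (abs_norm_sq_sub_of_mem_adaptedNhd hw)
  have hz0 : 0 < ‖z‖ := by
    by_contra h
    have : ‖z‖ = 0 := le_antisymm (not_lt.1 h) (norm_nonneg _)
    rw [this] at hz2
    norm_num at hz2
  have hw0 : 0 < ‖w‖ := by
    by_contra h
    have : ‖w‖ = 0 := le_antisymm (not_lt.1 h) (norm_nonneg _)
    rw [this] at hD
    linarith [hD.1]
  have hunit : ∀ {v : E N}, 0 < ‖v‖ → ‖(((‖v‖⁻¹ : ℝ) : ℂ) • v)‖ = 1 := fun {v} hv => by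
    rw [norm_smul, Complex.norm_real, norm_inv, norm_norm, inv_mul_cancel₀ hv.ne']
  refine ⟨hunit hw0, mem_carlesonWindow.2 ⟨hz1, by nlinarith, hunit hz0, ?_⟩⟩
  set D := 1 - ‖z‖ ^ 2 with hDdef
  set D' := 1 - ‖w‖ ^ 2 with hDdef'
  have hDD' : D < 2 * D' := by linarith
  have hD0 : 0 < D := by nlinarith
  set u : ℂ := inner ℂ z w with hu
  have hin : (inner ℂ (((‖z‖⁻¹ : ℝ) : ℂ) • z) (((‖w‖⁻¹ : ℝ) : ℂ) • w) : ℂ) =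
      u + (((‖z‖ * ‖w‖)⁻¹ - 1 : ℝ) : ℂ) * u := by
    rw [inner_smul_left, inner_smul_right, Complex.conj_ofReal, ← hu, mul_inv]
    push_cast
    ring
  have h1 : ‖1 - u‖ ≤ D + D / 8 := by
    have : 1 - u = ((D : ℝ) : ℂ) - inner ℂ z (w - z) := by
      rw [inner_sub_right, inner_self_eq_norm_sq_to_K, ← hu, hDdef]
      simp
    rw [this]
    refine (norm_sub_le _ _).trans ?_
    rw [Complex.norm_real, Real.norm_of_nonneg hD0.le]
    gcongr
    exact hw.1.le
  have hzw : 0 < ‖z‖ * ‖w‖ := by positivity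
  have hzw1 : ‖z‖ * ‖w‖ ≤ 1 := by nlinarith
  have h2 : ‖(((‖z‖ * ‖w‖)⁻¹ - 1 : ℝ) : ℂ) * u‖ ≤ D + D' := by
    rw [norm_mul, Complex.norm_real, Real.norm_of_nonneg (sub_nonneg.2 ((one_le_inv₀ hzw).2 hzw1))]
    have h3 : ‖u‖ ≤ ‖z‖ * ‖w‖ := norm_inner_le_norm z w
    calc ((‖z‖ * ‖w‖)⁻¹ - 1) * ‖u‖ ≤ ((‖z‖ * ‖w‖)⁻¹ - 1) * (‖z‖ * ‖w‖) := by
          gcongr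
          exact sub_nonneg.2 ((one_le_inv₀ hzw).2 hzw1)
      _ = 1 - ‖z‖ * ‖w‖ := by field_simp
      _ ≤ D + D' := by
          have h4 : ‖z‖ ^ 2 * ‖w‖ ^ 2 ≤ ‖z‖ * ‖w‖ := by
            rw [← mul_pow]; nlinarith
          have h5 : 0 ≤ D * D' := mul_nonneg hD0.le (by linarith)
          have h6 : ‖z‖ ^ 2 * ‖w‖ ^ 2 = 1 - D - D' + D * D' := by rw [hDdef, hDdef']; ring
          linarith
  rw [hin, ← sub_sub]
  refine (norm_sub_le _ _).trans_lt ?_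
  linarith

/-- The form in which the condition on `K_{μ,α}` is used: the windows of size `t` are controlled
by the value of the majorant at every larger `h`. -/
theorem KCondition.exists_rho_le {α : ℝ} {ψ₁ ψ₂ : ℝ → ℝ} {μ : Measure (E N)}
    (hK : KCondition α ψ₁ ψ₂ μ) {A ε : ℝ} (hA : 0 < A) (hε : 0 < ε) :
    ∃ h₀ : ℝ, 0 < h₀ ∧ ∀ t h : ℝ, 0 < t → t ≤ h → h < h₀ →
      rho μ t ≤ ENNReal.ofReal (ε * ((1 / h ^ ((N : ℝ) + 1 + α)) /
        ψ₂ (A * orliczInv ψ₁ (1 / h ^ ((N : ℝ) + 1 + α)))) * t ^ ((N : ℝ) + 1 + α)) := by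
  obtain ⟨h₀, hh₀, H⟩ := mem_nhdsGT_iff_exists_Ioo_subset.1 (hK A hA ε hε)
  refine ⟨h₀, hh₀, fun t h ht hth hh => ?_⟩
  have h1 := H ⟨ht.trans_le hth, hh⟩
  have h2 : rho μ t / ENNReal.ofReal (t ^ ((N : ℝ) + 1 + α)) ≤ carlesonK μ α h :=
    le_iSup₂ (f := fun t (_ : t ∈ Ioc (0 : ℝ) h) =>
      rho μ t / ENNReal.ofReal (t ^ ((N : ℝ) + 1 + α))) t ⟨ht, hth⟩
  have ht' : 0 < t ^ ((N : ℝ) + 1 + α) := Real.rpow_pos_of_pos ht _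
  have h3 := h2.trans h1
  rw [ENNReal.div_le_iff (by simpa using ht') ENNReal.ofReal_ne_top,
    ← ENNReal.ofReal_mul' ht'.le] at h3
  exact h3

/-- A Schur test: if for every `w` the points `z` related to `w` lie in a set `W` on which
`H ≤ c / μ W`, then `H` times integration over the related points is bounded by `c` on `L¹`. -/
theorem lintegral_mul_setLIntegral_le {X Y : Type*} [MeasurableSpace X] [MeasurableSpace Y]
    {μ : Measure X} {ν : Measure Y} [SFinite μ] [SFinite ν] {P : Set (X × Y)} (hP : MeasurableSet P)
    {H : X → ℝ≥0∞} (hH : Measurable H) {G : Y → ℝ≥0∞} (hG : Measurable G) {c : ℝ≥0∞}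
    (h : ∀ w, ∃ W : Set X, ∀ z, (z, w) ∈ P → z ∈ W ∧ H z ≤ c / μ W) :
    ∫⁻ z, H z * ∫⁻ w in {w | (z, w) ∈ P}, G w ∂ν ∂μ ≤ c * ∫⁻ w, G w ∂ν := by
  set k : X → Y → ℝ≥0∞ := fun z w => P.indicator (fun p => H p.1) (z, w)
  have hk1 : ∀ {z w}, (z, w) ∈ P → k z w = H z := fun hz => indicator_of_mem hz _
  have hk0 : ∀ {z w}, (z, w) ∉ P → k z w = 0 := fun hz => indicator_of_notMem hz _
  have hkm : Measurable (Function.uncurry k) := (hH.comp measurable_fst).indicator hP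
  calc ∫⁻ z, H z * ∫⁻ w in {w | (z, w) ∈ P}, G w ∂ν ∂μ
      = ∫⁻ z, ∫⁻ w, k z w * G w ∂ν ∂μ := by
        refine lintegral_congr fun z => ?_
        have hm : MeasurableSet {w | (z, w) ∈ P} := hP.preimage measurable_prodMk_left
        rw [← lintegral_indicator hm, ← lintegral_const_mul _ (hG.indicator hm)]
        refine lintegral_congr fun w => ?_
        by_cases hw : (z, w) ∈ P
        · rw [indicator_of_mem (show w ∈ {w | (z, w) ∈ P} from hw), hk1 hw]
        · rw [indicator_of_notMem (show w ∉ {w | (z, w) ∈ P} from hw), hk0 hw, mul_zero, zero_mul]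
    _ = ∫⁻ w, ∫⁻ z, k z w * G w ∂μ ∂ν :=
        lintegral_lintegral_swap (hkm.mul (hG.comp measurable_snd)).aemeasurable
    _ = ∫⁻ w, (∫⁻ z, k z w ∂μ) * G w ∂ν := by
        refine lintegral_congr fun w => ?_
        have hkw : Measurable fun z => k z w := hkm.comp measurable_prodMk_right
        rw [lintegral_mul_const _ hkw]
    _ ≤ ∫⁻ w, c * G w ∂ν := by
        refine lintegral_mono fun w => mul_le_mul_left ?_ _
        obtain ⟨W, hW⟩ := h w
        calc ∫⁻ z, k z w ∂μ ≤ ∫⁻ z, {z | (z, w) ∈ P}.indicator (fun _ => c / μ W) z ∂μ := by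
              refine lintegral_mono fun z => ?_
              by_cases hz : (z, w) ∈ P
              · rw [indicator_of_mem (show z ∈ {z | (z, w) ∈ P} from hz), hk1 hz]
                exact (hW z hz).2
              · rw [hk0 hz]
                exact zero_le
          _ ≤ c / μ W * μ {z | (z, w) ∈ P} := lintegral_indicator_const_le _ _
          _ ≤ c / μ W * μ W := by
              gcongr
              exact fun z hz => (hW z hz).1
          _ ≤ c := ENNReal.mul_le_of_le_div le_rfl
    _ = c * ∫⁻ w, G w ∂ν := lintegral_const_mul _ hG

/-- The uniform tail estimate behind sufficiency. The value `ψ₁(|f(z)|/C)` is bounded by the mean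
over the adapted neighbourhood of `z`; after exchanging the integrals, the points `z` whose
neighbourhood contains a given `w` lie in one window, and the condition on `K_{μ,α}`, applied at
the scale `h` with `h^{-(N+1+α)}` proportional to `ψ₁(|f(z)|/C)`, bounds the measure of that
window. -/
theorem exists_tail_le (hN : 1 ≤ N) {α : ℝ} (hα : -1 < α) {ψ₁ ψ₂ : ℝ → ℝ}
    (hψ₁ : IsOrlicz ψ₁) (hψ₂ : IsOrlicz ψ₂) {μ : Measure (E N)} [IsFiniteMeasure μ]
    (hμ : μ (unitBall N)ᶜ = 0) (hK : KCondition α ψ₁ ψ₂ μ) {C δ ε : ℝ} (hC : 0 < C) (hδ : 0 < δ)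
    (hε : 0 < ε) :
    ∃ R : ℝ, 0 < R ∧ ∀ f : E N → ℂ, Measurable f → DifferentiableOn ℂ f (unitBall N) →
      modular ψ₁ (weightedVolume N α) f C ≤ 1 →
      ∫⁻ z in {z | R < ‖f z‖}, ENNReal.ofReal (ψ₂ (‖f z‖ / δ)) ∂μ ≤ ENNReal.ofReal ε := by
  have := isFiniteMeasure_weightedVolume hN hα
  obtain ⟨C₁, hC₁, hsub⟩ := exists_submean hN hα
  have hq : 0 < (N : ℝ) + 1 + α := by
    have : (1 : ℝ) ≤ N := by exact_mod_cast hN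
    linarith
  set q := (N : ℝ) + 1 + α with hqdef
  have h12 : (1 : ℝ) ≤ 12 ^ q := Real.one_le_rpow (by norm_num) hq.le
  -- with this `κ`, the scale `h` defined by `1 / h ^ q = κ * g z` is at least `12 * (1 - ‖z‖ ^ 2)`
  set κ : ℝ := (12 ^ q * C₁)⁻¹ with hκ
  have hκ0 : 0 < κ := by positivity
  have hκ1 : κ ≤ 1 := inv_le_one_of_one_le₀ (one_le_mul_of_one_le_of_one_le h12 hC₁)
  obtain ⟨h₀, hh₀, H⟩ := hK.exists_rho_le (A := C / (δ * κ)) (by positivity) hε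
  rw [← hqdef] at H
  -- scales below `6` force `1 - ‖z‖ ^ 2 ≤ 1 / 2`, which keeps `z` away from the origin
  set h₁ := min h₀ 6 with hh₁
  have hh₁0 : 0 < h₁ := lt_min hh₀ (by norm_num)
  set g₀ : ℝ := (1 / h₁ ^ q) / κ with hg₀
  have hg₀0 : 0 < g₀ := by positivity
  refine ⟨C * orliczInv ψ₁ g₀, mul_pos hC (hψ₁.orliczInv_pos hg₀0), fun f hfm hf hmod => ?_⟩
  set R := C * orliczInv ψ₁ g₀ with hR
  have hR0 : 0 < R := mul_pos hC (hψ₁.orliczInv_pos hg₀0)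
  set g : E N → ℝ := fun z => ψ₁ (‖f z‖ / C) with hg
  have hgm : Measurable g := (hψ₁.continuous_norm_div hC.le).measurable.comp hfm
  set T : Set (E N) := unitBall N ∩ {z | R < ‖f z‖} with hT
  have hTm : MeasurableSet T :=
    (measurableSet_unitBall N).inter (measurableSet_lt measurable_const hfm.norm)
  have hTg : ∀ z ∈ T, g₀ < g z := by
    intro z hz
    rw [← hψ₁.map_orliczInv hg₀0.le]
    refine hψ₁.strictMonoOn (mem_Ici.2 (hψ₁.orliczInv_nonneg hg₀0.le))
      (mem_Ici.2 (by positivity)) ?_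
    rw [lt_div_iff₀ hC, mul_comm]
    exact hz.2
  have hD0 : ∀ z ∈ unitBall N, 0 < 1 - ‖z‖ ^ 2 := fun z hz => by
    have := mem_unitBall.1 hz
    nlinarith [norm_nonneg z]
  -- the pointwise growth estimate, from the sub-mean value inequality
  have hgrow : ∀ z ∈ unitBall N, g z * (1 - ‖z‖ ^ 2) ^ q ≤ C₁ := by
    intro z hz
    have h1 := hsub hψ₁ hfm hf hC hz
    have h2 : ∫⁻ w in adaptedNhd z, ENNReal.ofReal (ψ₁ (‖f w‖ / C)) ∂(weightedVolume N α) ≤ 1 :=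
      (setLIntegral_le_lintegral _ _).trans hmod
    have hDz := Real.rpow_pos_of_pos (hD0 z hz) q
    have h3 := h1.trans ((mul_le_mul_right h2 _).trans_eq (mul_one _))
    rw [ENNReal.ofReal_le_ofReal_iff (mul_nonneg (by linarith)
      (Real.rpow_nonneg (hD0 z hz).le _)), Real.rpow_neg (hD0 z hz).le, ← div_eq_mul_inv,
      le_div_iff₀ hDz] at h3
    exact h3
  set Φ : E N → ℝ := fun z => ψ₂ (‖f z‖ / δ) with hΦ
  have hΦm : Measurable Φ := (hψ₂.continuous_norm_div hδ.le).measurable.comp hfm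
  -- the choice of the scale `h` for a given `z`, and the resulting bound of the windows
  have hscale : ∀ z ∈ T, 1 - ‖z‖ ^ 2 ≤ 1 / 2 ∧ 0 < Φ z ∧ ∀ t, 0 < t → t ≤ 12 * (1 - ‖z‖ ^ 2) →
      rho μ t ≤ ENNReal.ofReal (ε * (κ * g z / Φ z) * t ^ q) := by
    intro z hz
    have hgz := hTg z hz
    have hgz0 : 0 < g z := hg₀0.trans hgz
    have hDz := hD0 z hz.1
    have hκg : 0 < κ * g z := by positivity
    set h : ℝ := ((κ * g z) ^ q⁻¹)⁻¹ with hh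
    have hh0 : 0 < h := by positivity
    have hhq : h ^ q = (κ * g z)⁻¹ := by
      rw [hh, Real.inv_rpow (by positivity), Real.rpow_inv_rpow hκg.le hq.ne']
    have hhq' : 1 / h ^ q = κ * g z := by rw [hhq, one_div, inv_inv]
    have hDh : 12 * (1 - ‖z‖ ^ 2) ≤ h := by
      rw [← Real.rpow_le_rpow_iff (by positivity) hh0.le hq, hhq,
        Real.mul_rpow (by norm_num) hDz.le, ← one_div, le_div_iff₀ hκg, hκ]
      have := hgrow z hz.1
      calc 12 ^ q * (1 - ‖z‖ ^ 2) ^ q * ((12 ^ q * C₁)⁻¹ * g z)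
          = (g z * (1 - ‖z‖ ^ 2) ^ q) / C₁ := by field_simp
        _ ≤ 1 := by rwa [div_le_one (by linarith)]
    have hhh : h < h₁ := by
      rw [← Real.rpow_lt_rpow_iff hh0.le hh₁0.le hq, hhq, inv_lt_comm₀ hκg (by positivity),
        ← one_div]
      rwa [hg₀, div_lt_iff₀ hκ0, mul_comm] at hgz
    have hfz : 0 < ‖f z‖ := hR0.trans hz.2
    have hΦ0 : 0 < Φ z := hψ₂.pos (by positivity)
    refine ⟨?_, hΦ0, fun t ht htD => ?_⟩
    · have : h < 6 := hhh.trans_le (min_le_right _ _)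
      linarith
    · refine (H t h ht (htD.trans hDh) (hhh.trans_le (min_le_left _ _))).trans
        (ENNReal.ofReal_le_ofReal ?_)
      rw [hhq']
      have hle : Φ z ≤ ψ₂ (C / (δ * κ) * orliczInv ψ₁ (κ * g z)) := by
        refine hψ₂.mono (by positivity) ?_
        have h1 : κ * (‖f z‖ / C) ≤ orliczInv ψ₁ (κ * g z) :=
          hψ₁.le_orliczInv hκg.le (by positivity) (hψ₁.map_mul_le hκ0.le hκ1 (by positivity))
        calc ‖f z‖ / δ = C / (δ * κ) * (κ * (‖f z‖ / C)) := by field_simp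
          _ ≤ _ := by gcongr
      gcongr
  set H' : E N → ℝ≥0∞ := fun z =>
    ENNReal.ofReal (Φ z / g z) * ENNReal.ofReal (C₁ * (1 - ‖z‖ ^ 2) ^ (-q)) with hH'
  have hH'm : Measurable H' := by
    have h1 : Measurable fun z : E N => C₁ * (1 - ‖z‖ ^ 2) ^ (-q) := by fun_prop
    exact (hΦm.div hgm).ennreal_ofReal.mul h1.ennreal_ofReal
  set P : Set (E N × E N) := {p | p.1 ∈ T ∧ p.2 ∈ adaptedNhd p.1} with hP
  have hPm : MeasurableSet P := (hTm.preimage measurable_fst).inter measurableSet_adaptedNhd_prod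
  set G : E N → ℝ≥0∞ := fun w => ENNReal.ofReal (g w) with hG
  have hGm : Measurable G := hgm.ennreal_ofReal
  have hrestrict : ∫⁻ z in {z | R < ‖f z‖}, ENNReal.ofReal (ψ₂ (‖f z‖ / δ)) ∂μ =
      ∫⁻ z, T.indicator (fun z => ENNReal.ofReal (Φ z)) z ∂μ := by
    rw [lintegral_indicator hTm]
    refine setLIntegral_congr ?_
    have : unitBall N =ᵐ[μ] univ := by rwa [ae_eq_univ]
    simpa using (this.inter (ae_eq_refl {z | R < ‖f z‖})).symm
  rw [hrestrict]
  calc ∫⁻ z, T.indicator (fun z => ENNReal.ofReal (Φ z)) z ∂μ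
      ≤ ∫⁻ z, H' z * ∫⁻ w in {w | (z, w) ∈ P}, G w ∂(weightedVolume N α) ∂μ := by
        refine lintegral_mono fun z => ?_
        by_cases hz : z ∈ T
        · rw [indicator_of_mem hz]
          have hgz : 0 < g z := hg₀0.trans (hTg z hz)
          have hΦz := (hscale z hz).2.1
          have hPz : {w | (z, w) ∈ P} = adaptedNhd z := by
            ext w
            exact and_iff_right hz
          rw [hPz]
          calc ENNReal.ofReal (Φ z) = ENNReal.ofReal (Φ z / g z) * ENNReal.ofReal (g z) := by
                rw [← ENNReal.ofReal_mul (by positivity), div_mul_cancel₀ _ hgz.ne']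
            _ ≤ ENNReal.ofReal (Φ z / g z) * (ENNReal.ofReal (C₁ * (1 - ‖z‖ ^ 2) ^ (-q)) *
                  ∫⁻ w in adaptedNhd z, G w ∂(weightedVolume N α)) :=
                mul_le_mul_right (hsub hψ₁ hfm hf hC hz.1) _
            _ = _ := (mul_assoc _ _ _).symm
        · rw [indicator_of_notMem hz]; exact zero_le
    _ ≤ ENNReal.ofReal ε * ∫⁻ w, G w ∂(weightedVolume N α) := by
        refine lintegral_mul_setLIntegral_le hPm hH'm hGm fun w => ?_
        set ζ : E N := ((‖w‖⁻¹ : ℝ) : ℂ) • w with hζ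
        refine ⟨carlesonWindow ζ (8 * (1 - ‖w‖ ^ 2)), fun z hz => ?_⟩
        have hzT : z ∈ T := hz.1
        have hzw : w ∈ adaptedNhd z := hz.2
        obtain ⟨h1, h3⟩ := mem_carlesonWindow_of_mem_adaptedNhd hzT.1 (hscale z hzT).1 hzw
        rw [← hζ] at h1 h3
        refine ⟨h3, ?_⟩
        have hDw := hD0 w (adaptedNhd_subset_unitBall hzT.1 hzw)
        have hDz := hD0 z hzT.1
        have hgz : 0 < g z := hg₀0.trans (hTg z hzT)
        have hΦz := (hscale z hzT).2.1
        have hDD := abs_lt.1 (abs_norm_sq_sub_of_mem_adaptedNhd hzw)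
        have hcmp : 8 * (1 - ‖w‖ ^ 2) ≤ 12 * (1 - ‖z‖ ^ 2) := by linarith
        have hρ := (measure_carlesonWindow_le_rho μ h1 _).trans
          ((hscale z hzT).2.2 (8 * (1 - ‖w‖ ^ 2)) (by positivity) hcmp)
        rw [ENNReal.le_div_iff_mul_le (Or.inr (by simpa using hε)) (Or.inl (measure_ne_top _ _))]
        refine (mul_le_mul_right hρ _).trans ?_
        have hDq : 0 < (1 - ‖z‖ ^ 2) ^ (-q) := Real.rpow_pos_of_pos hDz _
        change ENNReal.ofReal _ * ENNReal.ofReal _ * _ ≤ _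
        rw [← ENNReal.ofReal_mul (by positivity), ← ENNReal.ofReal_mul (by positivity)]
        refine ENNReal.ofReal_le_ofReal ?_
        have h8 : (8 * (1 - ‖w‖ ^ 2)) ^ q ≤ 12 ^ q * (1 - ‖z‖ ^ 2) ^ q := by
          rw [← Real.mul_rpow (by norm_num) hDz.le]
          gcongr
        calc Φ z / g z * (C₁ * (1 - ‖z‖ ^ 2) ^ (-q)) *
              (ε * (κ * g z / Φ z) * (8 * (1 - ‖w‖ ^ 2)) ^ q)
            ≤ Φ z / g z * (C₁ * (1 - ‖z‖ ^ 2) ^ (-q)) *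
              (ε * (κ * g z / Φ z) * (12 ^ q * (1 - ‖z‖ ^ 2) ^ q)) := by gcongr
          _ = ε := by
              have h0 : (1 - ‖z‖ ^ 2) ^ q ≠ 0 := (Real.rpow_pos_of_pos hDz q).ne'
              rw [Real.rpow_neg hDz.le, hκ]
              field_simp
    _ ≤ ENNReal.ofReal ε := mul_le_of_le_one_right' hmod

/-! ### Locally bounded families of holomorphic functions -/

theorem measurable_indicator_unitBall {f : E N → ℂ} (hf : DifferentiableOn ℂ f (unitBall N)) :
    Measurable ((unitBall N).indicator f) := by
  classical
  rw [← piecewise_eq_indicator]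
  exact hf.continuousOn.measurable_piecewise continuousOn_const (measurableSet_unitBall N)

theorem differentiableOn_indicator_unitBall {f : E N → ℂ}
    (hf : DifferentiableOn ℂ f (unitBall N)) :
    DifferentiableOn ℂ ((unitBall N).indicator f) (unitBall N) :=
  hf.congr fun _ hz => indicator_of_mem hz f

theorem indicator_unitBall_ae_eq {ν : Measure (E N)} (hν : ν (unitBall N)ᶜ = 0) (f : E N → ℂ) :
    (unitBall N).indicator f =ᵐ[ν] f := by
  have : ∀ᵐ z ∂ν, z ∈ unitBall N := hν
  filter_upwards [this] with z hz using indicator_of_mem hz f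

theorem modular_congr_ae {X : Type*} [MeasurableSpace X] {ψ : ℝ → ℝ} {ν : Measure X} {f g : X → ℂ}
    (h : f =ᵐ[ν] g) (C : ℝ) : modular ψ ν f C = modular ψ ν g C :=
  lintegral_congr_ae <| by filter_upwards [h] with x hx; rw [hx]

/-- A family bounded near a point of the ball is equicontinuous at this point, by the Schwarz
lemma. -/
theorem norm_sub_le_of_bounded {f : E N → ℂ} {z w : E N} {r M : ℝ}
    (hf : DifferentiableOn ℂ f (Metric.ball z r)) (hM : ∀ v ∈ Metric.ball z r, ‖f v‖ ≤ M)
    (hw : w ∈ Metric.ball z r) : ‖f w - f z‖ ≤ 2 * M / r * ‖w - z‖ := by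
  have hr : 0 < r := Metric.pos_of_mem_ball hw
  rw [← dist_eq_norm, ← dist_eq_norm]
  refine Complex.dist_le_div_mul_dist_of_mapsTo_ball hf (fun v hv => ?_) hw
  rw [Metric.mem_closedBall, dist_eq_norm]
  refine (norm_sub_le _ _).trans ?_
  linarith [hM v hv, hM z (Metric.mem_ball_self hr)]

/-- Montel's theorem in the form of pointwise convergence: a sequence of holomorphic functions on
the ball that is uniformly bounded near every point has a pointwise convergent subsequence. -/
theorem exists_subseq_tendsto {f : ℕ → E N → ℂ} (hf : ∀ n, DifferentiableOn ℂ (f n) (unitBall N))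
    (hb : ∀ z ∈ unitBall N, ∃ r M : ℝ, 0 < r ∧ Metric.ball z r ⊆ unitBall N ∧
      ∀ n, ∀ w ∈ Metric.ball z r, ‖f n w‖ ≤ M) :
    ∃ k : ℕ → ℕ, StrictMono k ∧ ∀ z ∈ unitBall N, ∃ y,
      Tendsto (fun n => f (k n) z) atTop (𝓝 y) := by
  obtain ⟨D, hDc, hDd⟩ := TopologicalSpace.exists_countable_dense (unitBall N)
  have : Countable D := hDc.to_subtype
  choose r M hr hrB hM using fun z : unitBall N => hb z z.2
  -- a diagonal subsequence converges at the points of a countable dense set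
  have hcpt : IsCompact (univ.pi fun d : D => Metric.closedBall (0 : ℂ) (M d)) :=
    isCompact_univ_pi fun _ => isCompact_closedBall _ _
  obtain ⟨y, -, k, hk, hlim⟩ := hcpt.tendsto_subseq (x := fun n (d : D) => f n (d : unitBall N))
    fun n d _ => by
      simpa using hM d n d (Metric.mem_ball_self (hr d))
  rw [tendsto_pi_nhds] at hlim
  refine ⟨k, hk, fun z hz => cauchySeq_tendsto_of_complete (Metric.cauchySeq_iff'.2 fun ε hε => ?_)⟩
  set z' : unitBall N := ⟨z, hz⟩
  have hM0 : 0 ≤ M z' := (norm_nonneg _).trans (hM z' 0 z (Metric.mem_ball_self (hr z')))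
  have hc : 0 < r z' ⊓ (ε / 4 / (2 * M z' / r z' + 1)) := by
    have := hr z'
    exact lt_min this (by positivity)
  obtain ⟨d, hd, hdz⟩ := hDd.exists_dist_lt z' hc
  have hdz' : dist (d : E N) z < r z' ⊓ (ε / 4 / (2 * M z' / r z' + 1)) := by
    rw [dist_comm]; exact hdz
  have hclose : ∀ n, ‖f n d - f n z‖ ≤ ε / 4 := by
    intro n
    have hpos : 0 < 2 * M z' / r z' + 1 := by have := hr z'; positivity
    have h1 := norm_sub_le_of_bounded ((hf n).mono (hrB z')) (hM z' n)
      (Metric.mem_ball.2 (hdz'.trans_le (min_le_left _ _)))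
    have h2 := (hdz'.trans_le (min_le_right _ _)).le
    rw [dist_eq_norm, le_div_iff₀ hpos] at h2
    refine h1.trans (le_trans ?_ h2)
    rw [mul_comm]
    gcongr
    linarith
  have hcauchy := (hlim ⟨d, hd⟩).cauchySeq
  obtain ⟨n₀, hn₀⟩ := Metric.cauchySeq_iff'.1 hcauchy (ε / 2) (by positivity)
  refine ⟨n₀, fun n hn => ?_⟩
  have h3 : ‖f (k n) d - f (k n₀) d‖ < ε / 2 := by
    rw [← dist_eq_norm]; exact hn₀ n hn
  have h4 := hclose (k n)
  have h5 := hclose (k n₀)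
  rw [dist_eq_norm]
  calc ‖f (k n) z - f (k n₀) z‖
      = ‖(f (k n) d - f (k n₀) d) - (f (k n) d - f (k n) z) + (f (k n₀) d - f (k n₀) z)‖ := by
        congr 1; ring
    _ ≤ ‖f (k n) d - f (k n₀) d‖ + ‖f (k n) d - f (k n) z‖ + ‖f (k n₀) d - f (k n₀) z‖ :=
        (norm_add_le _ _).trans (add_le_add_left (norm_sub_le _ _) _)
    _ < ε := by linarith

/-- Bounded subsets of the Bergman-Orlicz space are uniformly bounded near every point. -/
theorem exists_bound_near (hN : 1 ≤ N) {α : ℝ} (hα : -1 < α) {ψ : ℝ → ℝ} (hψ : IsOrlicz ψ)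
    {C : ℝ} (hC : 0 < C) {z : E N} (hz : z ∈ unitBall N) :
    ∃ r M : ℝ, 0 < r ∧ Metric.ball z r ⊆ unitBall N ∧ ∀ f : E N → ℂ, Measurable f →
      DifferentiableOn ℂ f (unitBall N) → modular ψ (weightedVolume N α) f C ≤ 1 →
      ∀ w ∈ Metric.ball z r, ‖f w‖ ≤ M := by
  obtain ⟨C₁, hC₁, hsub⟩ := exists_submean hN hα
  have hq : 0 < (N : ℝ) + 1 + α := by
    have : (1 : ℝ) ≤ N := by exact_mod_cast hN
    linarith
  have hz1 := mem_unitBall.1 hz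
  set ρ : ℝ := (1 + ‖z‖) / 2 with hρ
  have hρ1 : ρ < 1 := by linarith
  have hρ0 : 0 ≤ ρ := by positivity
  have hρ2 : 0 < 1 - ρ ^ 2 := by nlinarith
  set B := C₁ * (1 - ρ ^ 2) ^ (-((N : ℝ) + 1 + α)) with hB
  have hB0 : 0 ≤ B := by positivity
  have hsubB : ∀ w ∈ Metric.ball z ((1 - ‖z‖) / 2), ‖w‖ ≤ ρ := by
    intro w hw
    rw [mem_ball_iff_norm] at hw
    have := norm_le_norm_add_norm_sub' w z
    linarith
  refine ⟨(1 - ‖z‖) / 2, C * orliczInv ψ B, by linarith,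
    fun w hw => mem_unitBall.2 ((hsubB w hw).trans_lt hρ1), fun f hfm hf hmod w hw => ?_⟩
  have hwρ := hsubB w hw
  have h1 := (hsub hψ hfm hf hC (mem_unitBall.2 (hwρ.trans_lt hρ1))).trans
    ((mul_le_mul_right ((setLIntegral_le_lintegral _ _).trans hmod) _).trans_eq (mul_one _))
  have hw2 : 1 - ρ ^ 2 ≤ 1 - ‖w‖ ^ 2 := by gcongr
  rw [ENNReal.ofReal_le_ofReal_iff (by
    have := Real.rpow_nonneg (hρ2.le.trans hw2) (-((N : ℝ) + 1 + α)); positivity)] at h1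
  have h2 : ψ (‖f w‖ / C) ≤ B := by
    refine h1.trans ?_
    rw [hB]
    gcongr C₁ * ?_
    exact Real.rpow_le_rpow_of_nonpos hρ2 hw2 (by linarith)
  rw [← div_le_iff₀' hC]
  exact hψ.le_orliczInv hB0 (by positivity) h2

/-! ### Sufficiency of the condition on `K` -/

section Sufficiency

variable {α : ℝ} {ψ₁ ψ₂ : ℝ → ℝ} {μ : Measure (E N)}

/-- A tail bound passes to pointwise limits, by Fatou's lemma. -/
theorem tail_le_of_tendsto (hψ₂ : IsOrlicz ψ₂) {δ R ε : ℝ} (hδ : 0 < δ) {u : ℕ → E N → ℂ}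
    {v : E N → ℂ} (hu : ∀ m, Measurable (u m)) (hv : Measurable v)
    (hlim : ∀ z, Tendsto (fun m => u m z) atTop (𝓝 (v z)))
    (htail : ∀ m, ∫⁻ z in {z | R < ‖u m z‖}, ENNReal.ofReal (ψ₂ (‖u m z‖ / δ)) ∂μ ≤
      ENNReal.ofReal ε) :
    ∫⁻ z in {z | R < ‖v z‖}, ENNReal.ofReal (ψ₂ (‖v z‖ / δ)) ∂μ ≤ ENNReal.ofReal ε := by
  have hψc := hψ₂.continuous_norm_div hδ.le
  have hset : ∀ {x : E N → ℂ}, Measurable x → MeasurableSet {z | R < ‖x z‖} := fun hx =>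
    measurableSet_lt measurable_const hx.norm
  set F : ℕ → E N → ℝ≥0∞ := fun m =>
    {z | R < ‖u m z‖}.indicator fun z => ENNReal.ofReal (ψ₂ (‖u m z‖ / δ)) with hF
  have hFm : ∀ m, Measurable (F m) := fun m =>
    (hψc.measurable.comp (hu m)).ennreal_ofReal.indicator (hset (hu m))
  rw [← lintegral_indicator (hset hv)]
  calc ∫⁻ z, {z | R < ‖v z‖}.indicator (fun z => ENNReal.ofReal (ψ₂ (‖v z‖ / δ))) z ∂μ
      ≤ ∫⁻ z, liminf (fun m => F m z) atTop ∂μ := by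
        refine lintegral_mono fun z => ?_
        by_cases hz : z ∈ {z | R < ‖v z‖}
        · rw [indicator_of_mem hz]
          have h1 : Tendsto (fun m => ENNReal.ofReal (ψ₂ (‖u m z‖ / δ))) atTop
              (𝓝 (ENNReal.ofReal (ψ₂ (‖v z‖ / δ)))) :=
            ENNReal.tendsto_ofReal ((hψc.tendsto (v z)).comp (hlim z))
          have h2 : ∀ᶠ m in atTop, R < ‖u m z‖ := (hlim z).norm.eventually_const_lt hz
          refine (Tendsto.liminf_eq (h1.congr' ?_)).ge
          filter_upwards [h2] with m hm
          have hm' : z ∈ {z | R < ‖u m z‖} := hm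
          simp only [hF, indicator_of_mem hm']
        · rw [indicator_of_notMem hz]
          exact zero_le
    _ ≤ liminf (fun m => ∫⁻ z, F m z ∂μ) atTop := lintegral_liminf_le hFm
    _ ≤ ENNReal.ofReal ε := by
        refine liminf_le_of_frequently_le' (Frequently.of_forall fun m => ?_)
        rw [hF, lintegral_indicator (hset (hu m))]
        exact htail m

theorem modular_le_tail_add [IsFiniteMeasure μ] (hψ₂ : IsOrlicz ψ₂) {δ R : ℝ} (hδ : 0 < δ)
    {v : E N → ℂ} (hv : Measurable v) :
    modular ψ₂ μ v δ ≤ ∫⁻ z in {z | R < ‖v z‖}, ENNReal.ofReal (ψ₂ (‖v z‖ / δ)) ∂μ +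
      ENNReal.ofReal (ψ₂ (R / δ)) * μ univ := by
  have hm : MeasurableSet {z | R < ‖v z‖} := measurableSet_lt measurable_const hv.norm
  rw [modular, ← lintegral_add_compl _ hm]
  gcongr
  calc ∫⁻ z in {z | R < ‖v z‖}ᶜ, ENNReal.ofReal (ψ₂ (‖v z‖ / δ)) ∂μ
      ≤ ∫⁻ _ in {z | R < ‖v z‖}ᶜ, ENNReal.ofReal (ψ₂ (R / δ)) ∂μ := by
        refine setLIntegral_mono' hm.compl fun z hz => ENNReal.ofReal_le_ofReal ?_
        have hz' : ‖v z‖ ≤ R := not_lt.1 hz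
        exact hψ₂.mono (by positivity) (by gcongr)
    _ ≤ _ := by
        rw [setLIntegral_const]
        gcongr
        exact subset_univ _

/-- For a pointwise null sequence with uniformly small tails the modulars become small: the part
where the functions are bounded by `R` is handled by bounded convergence. -/
theorem eventually_modular_le_one [IsFiniteMeasure μ] (hψ₂ : IsOrlicz ψ₂) {δ R : ℝ} (hδ : 0 < δ)
    {v : ℕ → E N → ℂ} (hv : ∀ n, Measurable (v n))
    (hlim : ∀ z, Tendsto (fun n => v n z) atTop (𝓝 0))
    (htail : ∀ n, ∫⁻ z in {z | R < ‖v n z‖}, ENNReal.ofReal (ψ₂ (‖v n z‖ / δ)) ∂μ ≤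
      ENNReal.ofReal (1 / 2)) :
    ∀ᶠ n in atTop, modular ψ₂ μ (v n) δ ≤ 1 := by
  have hψc := hψ₂.continuous_norm_div hδ.le
  have hm : ∀ n, MeasurableSet {z | R < ‖v n z‖} := fun n =>
    measurableSet_lt measurable_const (hv n).norm
  set F : ℕ → E N → ℝ≥0∞ := fun n =>
    {z | R < ‖v n z‖}ᶜ.indicator fun z => ENNReal.ofReal (ψ₂ (‖v n z‖ / δ)) with hF
  have hFm : ∀ n, Measurable (F n) := fun n =>
    (hψc.measurable.comp (hv n)).ennreal_ofReal.indicator (hm n).compl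
  have h0 : Tendsto (fun n => ∫⁻ z, F n z ∂μ) atTop (𝓝 (∫⁻ _, 0 ∂μ)) := by
    refine tendsto_lintegral_of_dominated_convergence (fun _ => ENNReal.ofReal (ψ₂ (R / δ))) hFm
      (fun n => ae_of_all _ fun z => ?_) ?_ (ae_of_all _ fun z => ?_)
    · by_cases hz : R < ‖v n z‖
      · rw [hF]
        dsimp only
        rw [indicator_of_notMem (by simpa using hz)]
        exact zero_le
      · refine (indicator_le_self' (fun _ _ => zero_le) z).trans (ENNReal.ofReal_le_ofReal ?_)
        exact hψ₂.mono (by positivity) (by gcongr; exact not_lt.1 hz)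
    · rw [lintegral_const]
      exact (ENNReal.mul_lt_top ENNReal.ofReal_lt_top (measure_lt_top _ _)).ne
    · refine tendsto_of_tendsto_of_tendsto_of_le_of_le tendsto_const_nhds
        (h := fun n => ENNReal.ofReal (ψ₂ (‖v n z‖ / δ))) ?_ (fun _ => zero_le)
        (fun n => indicator_le_self' (fun _ _ => zero_le) z)
      have := ENNReal.tendsto_ofReal ((hψc.tendsto 0).comp (hlim z))
      simpa [hψ₂.map_zero] using this
  rw [lintegral_zero] at h0
  filter_upwards [h0.eventually (ge_mem_nhds (show (0 : ℝ≥0∞) < ENNReal.ofReal (1 / 2) by simp))]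
    with n hn
  rw [modular, ← lintegral_add_compl _ (hm n), ← lintegral_indicator (hm n).compl]
  refine (add_le_add (htail n) hn).trans ?_
  rw [← ENNReal.ofReal_add (by norm_num) (by norm_num)]
  norm_num

/-- Sufficiency. The limit of the extracted subsequence is only known pointwise; the tail bounds of
the differences `F (k n) - F (k m)` pass to it as `m → ∞`. -/
theorem KCondition.compactEmbedding (hN : 1 ≤ N) (hα : -1 < α) (hψ₁ : IsOrlicz ψ₁)
    (hψ₂ : IsOrlicz ψ₂) [IsFiniteMeasure μ] (hμ : μ (unitBall N)ᶜ = 0)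
    (hK : KCondition α ψ₁ ψ₂ μ) : CompactEmbedding N α ψ₁ ψ₂ μ := by
  refine ⟨fun f hf => ?_, fun f hf => ?_⟩
  · obtain ⟨C, hC, hmod⟩ := hf.2.exists_modular_le_one hψ₁
    have hae := indicator_unitBall_ae_eq hμ f
    have hfm := measurable_indicator_unitBall hf.1
    obtain ⟨R, hR, htail⟩ := exists_tail_le hN hα hψ₁ hψ₂ hμ hK hC one_pos one_pos
    refine ⟨⟨_, hfm.stronglyMeasurable, hae.symm⟩, 1, one_pos, ?_⟩
    rw [← modular_congr_ae hae]
    refine (modular_le_tail_add hψ₂ one_pos hfm (R := R)).trans_lt (ENNReal.add_lt_top.2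
      ⟨(htail _ hfm (differentiableOn_indicator_unitBall hf.1) ?_).trans_lt ENNReal.ofReal_lt_top,
        ENNReal.mul_lt_top ENNReal.ofReal_lt_top (measure_lt_top _ _)⟩)
    rwa [modular_congr_ae (indicator_unitBall_ae_eq (weightedVolume_compl_unitBall α) f)]
  · set F : ℕ → E N → ℂ := fun n => (unitBall N).indicator (f n) with hF
    have hFm : ∀ n, Measurable (F n) := fun n => measurable_indicator_unitBall (hf n).1.1
    have hFd : ∀ n, DifferentiableOn ℂ (F n) (unitBall N) := fun n =>
      differentiableOn_indicator_unitBall (hf n).1.1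
    -- the constant `2` is strictly above the norm bound, so that no attained infimum is needed
    have hFmod : ∀ n, modular ψ₁ (weightedVolume N α) (F n) 2 ≤ 1 := fun n => by
      rw [modular_congr_ae (indicator_unitBall_ae_eq (weightedVolume_compl_unitBall α) (f n))]
      refine modular_le_one_of_luxemburgNorm_lt hψ₁ ((hf n).2.trans_lt ?_)
      simp
    obtain ⟨k, hk, hlim⟩ := exists_subseq_tendsto hFd fun z hz => by
      obtain ⟨r, M, hr, hrB, h⟩ := exists_bound_near hN hα hψ₁ two_pos hz
      exact ⟨r, M, hr, hrB, fun n => h _ (hFm n) (hFd n) (hFmod n)⟩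
    -- outside the ball the truncated functions vanish, so the limit exists everywhere
    have hlim' : ∀ z, ∃ y, Tendsto (fun n => F (k n) z) atTop (𝓝 y) := fun z => by
      by_cases hz : z ∈ unitBall N
      · exact hlim z hz
      · exact ⟨0, by simp [hF, hz]⟩
    choose g hg using hlim'
    have hgm : Measurable g :=
      measurable_of_tendsto_metrizable (fun n => hFm (k n)) (tendsto_pi_nhds.2 hg)
    have hFk : ∀ n m, modular ψ₁ (weightedVolume N α) (fun z => F (k n) z - F (k m) z) 4 ≤ 1 :=
      fun n m => by
        have := modular_sub_le hψ₁ (hFm (k n)).aestronglyMeasurable two_pos (hFmod (k n))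
          (hFmod (k m))
        norm_num at this
        exact this
    refine ⟨g, k, ⟨hgm.aestronglyMeasurable, 1, one_pos, ?_⟩, hk, ?_⟩
    · obtain ⟨R, hR, htail⟩ := exists_tail_le hN hα hψ₁ hψ₂ hμ hK two_pos one_pos one_pos
      have := tail_le_of_tendsto hψ₂ one_pos (fun n => hFm (k n)) hgm hg
        fun m => htail _ (hFm (k m)) (hFd (k m)) (hFmod (k m))
      exact (modular_le_tail_add hψ₂ one_pos hgm (R := R)).trans_lt (ENNReal.add_lt_top.2
        ⟨this.trans_lt ENNReal.ofReal_lt_top,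
          ENNReal.mul_lt_top ENNReal.ofReal_lt_top (measure_lt_top _ _)⟩)
    · have hsmall : ∀ δ : ℝ, 0 < δ → ∀ᶠ n in atTop,
          luxemburgNorm ψ₂ μ (fun z => f (k n) z - g z) ≤ ENNReal.ofReal δ := by
        intro δ hδ
        obtain ⟨R, hR, htail⟩ := exists_tail_le hN hα hψ₁ hψ₂ hμ hK (C := 4) (ε := 1 / 2)
          (by norm_num) hδ (by norm_num)
        have htail' : ∀ n, ∫⁻ z in {z | R < ‖F (k n) z - g z‖},
            ENNReal.ofReal (ψ₂ (‖F (k n) z - g z‖ / δ)) ∂μ ≤ ENNReal.ofReal (1 / 2) := fun n =>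
          tail_le_of_tendsto hψ₂ hδ (fun m => (hFm (k n)).sub (hFm (k m))) ((hFm (k n)).sub hgm)
            (fun z => tendsto_const_nhds.sub (hg z)) fun m =>
              htail _ ((hFm (k n)).sub (hFm (k m))) ((hFd (k n)).sub (hFd (k m))) (hFk n m)
        filter_upwards [eventually_modular_le_one hψ₂ hδ (fun n => (hFm (k n)).sub hgm)
          (fun z => by simpa using (hg z).sub_const (g z)) htail'] with n hn
        refine luxemburgNorm_le hδ ?_
        rw [← modular_congr_ae (f := fun z => F (k n) z - g z)]
        · exact hn
        · filter_upwards [indicator_unitBall_ae_eq hμ (f (k n))] with z hz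
          rw [← hz]
      refine ENNReal.tendsto_nhds_zero.2 fun ε hε => ?_
      rcases eq_or_ne ε ∞ with rfl | hε'
      · exact Eventually.of_forall fun _ => le_top
      · have := hsmall ε.toReal (ENNReal.toReal_pos hε.ne' hε')
        rwa [ENNReal.ofReal_toReal hε'] at this

end Sufficiency

/-! ### Test functions -/

/-- The test function peaking at the boundary point `ξ` at the scale `h`: a power of the quotient
of `h` by `1 - ⟨z, (1 - h) ξ⟩`. -/
noncomputable def testFun (p : ℕ) (ξ : E N) (h : ℝ) (z : E N) : ℂ :=
  ((h : ℂ) / (1 - ((1 - h : ℝ) : ℂ) * inner ℂ ξ z)) ^ p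

section TestFun

variable {p : ℕ} {ξ z : E N} {h : ℝ}

theorem norm_inner_le_of_unit (hξ : ‖ξ‖ = 1) (z : E N) : ‖(inner ℂ ξ z : ℂ)‖ ≤ ‖z‖ := by
  simpa [hξ] using norm_inner_le_norm (𝕜 := ℂ) ξ z

theorem norm_testFun (hh : 0 ≤ h) :
    ‖testFun p ξ h z‖ = (h / ‖1 - ((1 - h : ℝ) : ℂ) * inner ℂ ξ z‖) ^ p := by
  rw [testFun, norm_pow, norm_div, Complex.norm_real, Real.norm_of_nonneg hh]

/-- The denominator of the test function stays away from zero on the closed ball. -/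
theorem one_sub_mul_le_norm (hξ : ‖ξ‖ = 1) (hh1 : h ≤ 1) (z : E N) :
    1 - (1 - h) * ‖z‖ ≤ ‖1 - ((1 - h : ℝ) : ℂ) * inner ℂ ξ z‖ := by
  have h1 := norm_sub_norm_le (1 : ℂ) (((1 - h : ℝ) : ℂ) * inner ℂ ξ z)
  rw [norm_one, norm_mul, Complex.norm_real, Real.norm_of_nonneg (sub_nonneg.2 hh1)] at h1
  have h2 : (1 - h) * ‖(inner ℂ ξ z : ℂ)‖ ≤ (1 - h) * ‖z‖ :=
    mul_le_mul_of_nonneg_left (norm_inner_le_of_unit hξ z) (sub_nonneg.2 hh1)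
  linarith

theorem differentiableOn_testFun (hξ : ‖ξ‖ = 1) (hh : 0 < h) (hh1 : h ≤ 1) :
    DifferentiableOn ℂ (testFun p ξ h) (unitBall N) := by
  intro z hz
  have hne : 1 - ((1 - h : ℝ) : ℂ) * inner ℂ ξ z ≠ 0 := by
    rw [← norm_pos_iff]
    refine lt_of_lt_of_le ?_ (one_sub_mul_le_norm hξ hh1 z)
    nlinarith [mem_unitBall.1 hz, norm_nonneg z]
  have hin : DifferentiableAt ℂ (fun z : E N => (inner ℂ ξ z : ℂ)) z :=
    (innerSL ℂ ξ).differentiableAt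
  unfold testFun
  exact (DifferentiableAt.pow (by fun_prop (disch := exact hne)) p).differentiableWithinAt

theorem norm_testFun_le_one (hξ : ‖ξ‖ = 1) (hh : 0 < h) (hh1 : h ≤ 1) (hz : ‖z‖ ≤ 1) :
    ‖testFun p ξ h z‖ ≤ 1 := by
  rw [norm_testFun hh.le]
  refine pow_le_one₀ (by positivity) (div_le_one_of_le₀ ?_ (norm_nonneg _))
  refine le_trans ?_ (one_sub_mul_le_norm hξ hh1 z)
  nlinarith

theorem norm_testFun_le (hξ : ‖ξ‖ = 1) (hh : 0 < h) (hh1 : h ≤ 1) (hz : ‖z‖ < 1) :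
    ‖testFun p ξ h z‖ ≤ (h / (1 - ‖z‖)) ^ p := by
  rw [norm_testFun hh.le]
  gcongr ?_ ^ p
  refine div_le_div_of_nonneg_left hh.le (by linarith) ?_
  refine le_trans ?_ (one_sub_mul_le_norm hξ hh1 z)
  nlinarith [norm_nonneg z]

/-- Away from the peak the test function decays like a power of the nonisotropic distance. -/
theorem norm_testFun_le_of_le (hξ : ‖ξ‖ = 1) (hh : 0 < h) (hh1 : h ≤ 1) (hz : ‖z‖ ≤ 1) {d : ℝ}
    (hd : 0 < d) (hdz : d * h ≤ ‖1 - (inner ℂ ξ z : ℂ)‖) : ‖testFun p ξ h z‖ ≤ (2 / d) ^ p := by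
  rw [norm_testFun hh.le]
  have h1 : h ≤ ‖1 - ((1 - h : ℝ) : ℂ) * inner ℂ ξ z‖ := by
    refine le_trans ?_ (one_sub_mul_le_norm hξ hh1 z)
    nlinarith
  have h2 : ‖1 - (inner ℂ ξ z : ℂ)‖ ≤ ‖1 - ((1 - h : ℝ) : ℂ) * inner ℂ ξ z‖ + h := by
    have : 1 - (inner ℂ ξ z : ℂ) =
        (1 - ((1 - h : ℝ) : ℂ) * inner ℂ ξ z) - (h : ℂ) * inner ℂ ξ z := by
      push_cast; ring
    rw [this]
    refine (norm_sub_le _ _).trans ?_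
    rw [norm_mul, Complex.norm_real, Real.norm_of_nonneg hh.le]
    gcongr
    exact mul_le_of_le_one_right hh.le ((norm_inner_le_of_unit hξ z).trans hz)
  have h3 : 0 < ‖1 - ((1 - h : ℝ) : ℂ) * inner ℂ ξ z‖ := hh.trans_le h1
  gcongr ?_ ^ p
  rw [div_le_div_iff₀ h3 hd]
  linarith

theorem le_norm_testFun_of_mem_carlesonWindow (hξ : ‖ξ‖ = 1) (hh : 0 < h) (hh1 : h ≤ 1)
    (hz : z ∈ carlesonWindow ξ h) : (1 / 3) ^ p ≤ ‖testFun p ξ h z‖ := by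
  obtain ⟨hz1, hz2, hz3, hz4⟩ := mem_carlesonWindow.1 hz
  rw [norm_testFun hh.le]
  have hz0 : 0 < ‖z‖ := by
    rw [norm_pos_iff]
    rintro rfl
    simp at hz3
  set v : ℂ := inner ℂ ξ (((‖z‖⁻¹ : ℝ) : ℂ) • z) with hv
  have hv1 : ‖1 - v‖ < h := by
    have : 1 - v = (starRingEnd ℂ) (1 - inner ℂ (((‖z‖⁻¹ : ℝ) : ℂ) • z) ξ) := by
      rw [map_sub, map_one, inner_conj_symm]
    rw [this, RCLike.norm_conj]
    exact hz4
  have hin : (inner ℂ ξ z : ℂ) = (‖z‖ : ℂ) * v := by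
    rw [hv, inner_smul_right, ← mul_assoc, ← Complex.ofReal_mul, mul_inv_cancel₀ hz0.ne',
      Complex.ofReal_one, one_mul]
  have hs : 0 ≤ (1 - h) * ‖z‖ := mul_nonneg (by linarith) hz0.le
  have hs1 : (1 - h) * ‖z‖ ≤ 1 := by nlinarith
  have hle : ‖1 - ((1 - h : ℝ) : ℂ) * inner ℂ ξ z‖ ≤ 3 * h := by
    have : 1 - ((1 - h : ℝ) : ℂ) * inner ℂ ξ z =
        ((1 - (1 - h) * ‖z‖ : ℝ) : ℂ) + (((1 - h) * ‖z‖ : ℝ) : ℂ) * (1 - v) := by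
      rw [hin]; push_cast; ring
    rw [this]
    refine (norm_add_le _ _).trans ?_
    rw [norm_mul, Complex.norm_real, Complex.norm_real, Real.norm_of_nonneg hs,
      Real.norm_of_nonneg (by linarith)]
    have h5 : (1 - h) * ‖z‖ * ‖1 - v‖ ≤ 1 * h := mul_le_mul hs1 hv1.le (norm_nonneg _) zero_le_one
    nlinarith
  have hpos : 0 < ‖1 - ((1 - h : ℝ) : ℂ) * inner ℂ ξ z‖ :=
    lt_of_lt_of_le (by nlinarith) (one_sub_mul_le_norm hξ hh1 z)
  gcongr ?_ ^ p
  rw [div_le_div_iff₀ (by norm_num) hpos]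
  linarith

/-- The `L¹(v_α)`-norm of the test function of exponent `p ≥ N + 2 + α` is of order
`h^(N+1+α)`, by summation over dyadic nonisotropic balls. -/
theorem exists_lintegral_testFun_le (hN : 1 ≤ N) {α : ℝ} (hα : -1 < α)
    (hp : (N : ℝ) + 1 + α + 1 ≤ p) : ∃ C : ℝ, 1 ≤ C ∧ ∀ ξ : E N, ‖ξ‖ = 1 → ∀ h : ℝ, 0 < h → h ≤ 1 →
      ∫⁻ z, ENNReal.ofReal ‖testFun p ξ h z‖ ∂(weightedVolume N α) ≤
        ENNReal.ofReal (C * h ^ ((N : ℝ) + 1 + α)) := by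
  obtain ⟨C, hC, hvol⟩ := exists_weightedVolume_le hN hα
  set q := (N : ℝ) + 1 + α with hq
  refine ⟨max 1 (2 ^ p * C * 2 ^ q * 2), le_max_left _ _, fun ξ hξ h hh hh1 => ?_⟩
  set U : ℕ → Set (E N) := fun k => {z | ‖1 - (inner ℂ ξ z : ℂ)‖ < 2 ^ (k + 1) * h} with hU
  have hUm : ∀ k, MeasurableSet (U k) := fun k =>
    (isOpen_lt (by fun_prop) (by fun_prop)).measurableSet
  set b : ℕ → ℝ := fun k => (2 / 2 ^ k) ^ p with hb
  have hb0 : ∀ k, 0 ≤ b k := fun k => by positivity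
  have hae : ∀ᵐ z ∂(weightedVolume N α), z ∈ unitBall N := weightedVolume_compl_unitBall α
  have hpt : ∀ᵐ z ∂(weightedVolume N α), ENNReal.ofReal ‖testFun p ξ h z‖ ≤
      ∑' k, (U k).indicator (fun _ => ENNReal.ofReal (b k)) z := by
    filter_upwards [hae] with z hz
    have hz1 := mem_unitBall.1 hz
    obtain ⟨n, hn⟩ : ∃ n : ℕ, z ∈ U n := by
      obtain ⟨n, hn⟩ := pow_unbounded_of_one_lt (‖1 - (inner ℂ ξ z : ℂ)‖ / h) one_lt_two
      refine ⟨n, ?_⟩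
      rw [div_lt_iff₀ hh] at hn
      refine hn.trans_le ?_
      gcongr
      · norm_num
      · omega
    classical
    set k := Nat.find (⟨n, hn⟩ : ∃ n : ℕ, z ∈ U n) with hk
    have hkU : z ∈ U k := Nat.find_spec (⟨n, hn⟩ : ∃ n : ℕ, z ∈ U n)
    refine le_trans ?_ (ENNReal.le_tsum k)
    rw [indicator_of_mem hkU]
    refine ENNReal.ofReal_le_ofReal ?_
    rcases Nat.eq_zero_or_pos k with h0 | h0
    · rw [h0]
      refine (norm_testFun_le_one hξ hh hh1 hz1.le).trans ?_
      simp only [hb, pow_zero, div_one]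
      exact one_le_pow₀ one_le_two
    · refine norm_testFun_le_of_le hξ hh hh1 hz1.le (by positivity) ?_
      have := Nat.find_min (⟨n, hn⟩ : ∃ n : ℕ, z ∈ U n) (m := k - 1) (by omega)
      have h7 : ¬ ‖1 - (inner ℂ ξ z : ℂ)‖ < 2 ^ (k - 1 + 1) * h := this
      rw [Nat.sub_add_cancel h0] at h7
      exact not_lt.1 h7
  calc ∫⁻ z, ENNReal.ofReal ‖testFun p ξ h z‖ ∂(weightedVolume N α)
      ≤ ∫⁻ z, ∑' k, (U k).indicator (fun _ => ENNReal.ofReal (b k)) z ∂(weightedVolume N α) :=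
        lintegral_mono_ae hpt
    _ = ∑' k, ENNReal.ofReal (b k) * weightedVolume N α (U k) := by
        rw [lintegral_tsum fun k => (measurable_const.indicator (hUm k)).aemeasurable]
        simp_rw [lintegral_indicator_const (hUm _)]
    _ ≤ ∑' k : ℕ, ENNReal.ofReal (2 ^ p * C * 2 ^ q * h ^ q) * 2⁻¹ ^ k := by
        refine ENNReal.tsum_le_tsum fun k => ?_
        refine (mul_le_mul_right (hvol ξ hξ _ (by positivity)) _).trans ?_
        have h2 : (2⁻¹ : ℝ≥0∞) ^ k = ENNReal.ofReal ((1 / 2) ^ k) := by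
          rw [ENNReal.ofReal_pow (by norm_num), one_div, ENNReal.ofReal_inv_of_pos two_pos]
          simp
        rw [h2, ← ENNReal.ofReal_mul (hb0 k), ← ENNReal.ofReal_mul (by positivity)]
        refine ENNReal.ofReal_le_ofReal ?_
        have h3 : (2 ^ (k + 1) * h) ^ q = ((2 : ℝ) ^ k) ^ q * 2 ^ q * h ^ q := by
          rw [Real.mul_rpow (by positivity) hh.le, pow_succ,
            Real.mul_rpow (by positivity) (by norm_num)]
        have h4 : ((2 : ℝ) ^ k) ^ q * 2 ^ k ≤ ((2 : ℝ) ^ k) ^ p := by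
          rw [← Real.rpow_natCast ((2 : ℝ) ^ k) p]
          refine le_trans (le_of_eq ?_) (Real.rpow_le_rpow_of_exponent_le
            (one_le_pow₀ one_le_two) hp)
          rw [Real.rpow_add (by positivity) q 1, Real.rpow_one]
        rw [h3, hb]
        dsimp only
        rw [div_pow, one_div, inv_pow]
        have h5 : ((2 : ℝ) ^ k) ^ q / ((2 : ℝ) ^ k) ^ p ≤ (2 ^ k)⁻¹ := by
          rw [← one_div, div_le_div_iff₀ (by positivity) (by positivity), one_mul]
          exact h4
        calc (2 : ℝ) ^ p / (2 ^ k) ^ p * (C * ((2 ^ k) ^ q * 2 ^ q * h ^ q))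
            = 2 ^ p * C * 2 ^ q * h ^ q * (((2 : ℝ) ^ k) ^ q / ((2 : ℝ) ^ k) ^ p) := by ring
          _ ≤ _ := by gcongr
    _ = ENNReal.ofReal (2 ^ p * C * 2 ^ q * h ^ q) * 2 := by
        rw [ENNReal.tsum_mul_left, ENNReal.tsum_geometric, ENNReal.one_sub_inv_two, inv_inv]
    _ ≤ _ := by
        rw [show (2 : ℝ≥0∞) = ENNReal.ofReal 2 by simp, ← ENNReal.ofReal_mul (by positivity)]
        refine ENNReal.ofReal_le_ofReal ?_
        calc 2 ^ p * C * 2 ^ q * h ^ q * 2 = 2 ^ p * C * 2 ^ q * 2 * h ^ q := by ring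
          _ ≤ _ := by gcongr; exact le_max_right _ _

end TestFun

variable {α : ℝ} {ψ ψ₁ ψ₂ : ℝ → ℝ} {μ : Measure (E N)}

/-! ### Necessity of the condition on `ϱ` -/

/-- A function whose modulars at all levels are at most one vanishes: by convexity the modular at
level `1` is at most `δ` times the modular at level `δ`. -/
theorem ae_eq_zero_of_modular_le_one {X : Type*} [MeasurableSpace X] {ν : Measure X}
    (hψ : IsOrlicz ψ) {g : X → ℂ} (hg : AEStronglyMeasurable g ν)
    (h : ∀ δ : ℝ, 0 < δ → modular ψ ν g δ ≤ 1) : ∀ᵐ x ∂ν, g x = 0 := by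
  have h0 : modular ψ ν g 1 ≤ 0 := by
    refine ENNReal.le_of_forall_pos_le_add fun ε hε _ => ?_
    set M : ℝ := max 1 (ε : ℝ)⁻¹ with hM
    have hε' : (0 : ℝ) < ε := by exact_mod_cast hε
    have hM0 : 0 < M := by positivity
    have h1 := modular_mul_le (μ := ν) (f := g) hψ (inv_pos.2 hM0) (le_max_left 1 (ε : ℝ)⁻¹)
    rw [← hM, inv_mul_cancel₀ hM0.ne'] at h1
    refine (h1.trans (mul_le_of_le_one_right' (h _ (inv_pos.2 hM0)))).trans ?_
    rw [zero_add, ← ENNReal.ofReal_coe_nnreal]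
    exact ENNReal.ofReal_le_ofReal (inv_le_of_inv_le₀ hε' (le_max_right _ _))
  have hm : AEMeasurable (fun x => ENNReal.ofReal (ψ (‖g x‖ / 1))) ν :=
    ((hψ.continuous_norm_div zero_le_one).measurable.comp_aemeasurable
      hg.aemeasurable).ennreal_ofReal
  have h2 := (lintegral_eq_zero_iff' hm).1 (le_antisymm h0 zero_le)
  filter_upwards [h2] with x hx
  by_contra hne
  have := hψ.pos (norm_pos_iff.2 hne)
  simp only [div_one, Pi.zero_apply, ENNReal.ofReal_eq_zero] at hx
  linarith

/-- A sequence that tends to zero almost everywhere and converges in the Luxemburg norm converges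
to zero. -/
theorem ae_eq_zero_of_tendsto {X : Type*} [MeasurableSpace X] {ν : Measure X}
    (hψ : IsOrlicz ψ) {f : ℕ → X → ℂ} {g : X → ℂ} (hf : ∀ n, AEStronglyMeasurable (f n) ν)
    (hg : AEStronglyMeasurable g ν) (hf0 : ∀ᵐ x ∂ν, Tendsto (fun n => f n x) atTop (𝓝 0))
    (hlim : ∀ δ : ℝ, 0 < δ → ∀ᶠ n in atTop, modular ψ ν (fun x => f n x - g x) δ ≤ 1) :
    ∀ᵐ x ∂ν, g x = 0 := by
  refine ae_eq_zero_of_modular_le_one hψ hg fun δ hδ => ?_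
  have hψc := hψ.continuous_norm_div hδ.le
  calc modular ψ ν g δ
      ≤ ∫⁻ x, liminf (fun n => ENNReal.ofReal (ψ (‖f n x - g x‖ / δ))) atTop ∂ν := by
        refine lintegral_mono_ae ?_
        filter_upwards [hf0] with x hx
        have h1 : Tendsto (fun n => f n x - g x) atTop (𝓝 (0 - g x)) := hx.sub_const _
        have h2 := ENNReal.tendsto_ofReal ((hψc.tendsto _).comp h1)
        rw [zero_sub, norm_neg] at h2
        exact h2.liminf_eq.ge
    _ ≤ liminf (fun n => modular ψ ν (fun x => f n x - g x) δ) atTop :=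
        lintegral_liminf_le' fun n =>
          (hψc.measurable.comp_aemeasurable ((hf n).sub hg).aemeasurable).ennreal_ofReal
    _ ≤ 1 := liminf_le_of_frequently_le' (hlim δ hδ).frequently

/-- Necessity. If the condition fails along scales `h n → 0`, normalized test functions peaking at
the offending windows form a bounded sequence without any subsequence converging in `L^{ψ₂}(μ)`. -/
theorem CompactEmbedding.rhoCondition (hN : 1 ≤ N) (hα : -1 < α) (hψ₁ : IsOrlicz ψ₁)
    (hψ₂ : IsOrlicz ψ₂) (hμ : μ (unitBall N)ᶜ = 0)
    (hc : CompactEmbedding N α ψ₁ ψ₂ μ) : RhoCondition α ψ₁ ψ₂ μ := by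
  intro A hA ε hε
  by_contra hcon
  set q := (N : ℝ) + 1 + α with hq
  have hq0 : 0 < q := by
    have : (1 : ℝ) ≤ N := by exact_mod_cast hN
    linarith
  have hIoo : ∀ᶠ h in 𝓝[>] (0 : ℝ), h ∈ Ioo (0 : ℝ) 1 := Ioo_mem_nhdsGT one_pos
  obtain ⟨h, hh0, hh⟩ := exists_seq_forall_of_frequently
    ((not_eventually.1 hcon).and_eventually hIoo)
  have hbad : ∀ n, ∃ ξ : E N, ‖ξ‖ = 1 ∧
      ENNReal.ofReal (ε * (1 / ψ₂ (A * orliczInv ψ₁ (1 / h n ^ q)))) <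
        μ (carlesonWindow ξ (h n)) := by
    intro n
    have h1 := not_le.1 (hh n).1
    obtain ⟨ξ, hξ⟩ := lt_iSup_iff.1 h1
    obtain ⟨hξS, hξ⟩ := lt_iSup_iff.1 hξ
    exact ⟨ξ, mem_unitSphere.1 hξS, hξ⟩
  choose ξ hξ hbig using hbad
  have hpos : ∀ n, 0 < h n := fun n => (hh n).2.1
  have hle : ∀ n, h n ≤ 1 := fun n => (hh n).2.2.le
  have hlim0 : Tendsto h atTop (𝓝 0) := hh0.mono_right nhdsWithin_le_nhds
  obtain ⟨p, hp⟩ := exists_nat_ge (q + 1)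
  obtain ⟨C, hC, hint⟩ := exists_lintegral_testFun_le hN hα hp
  rw [← hq] at hint
  set s : ℕ → ℝ := fun n => orliczInv ψ₁ (1 / h n ^ q) with hs
  have hhq : ∀ n, 0 < 1 / h n ^ q := fun n => by
    have := hpos n
    positivity
  have hs0 : ∀ n, 0 < s n := fun n => hψ₁.orliczInv_pos (hhq n)
  set f : ℕ → E N → ℂ := fun n z => ((s n / C : ℝ) : ℂ) * testFun p (ξ n) (h n) z with hf
  have hC0 : 0 < C := by linarith
  have hfnorm : ∀ n z, ‖f n z‖ = s n / C * ‖testFun p (ξ n) (h n) z‖ := fun n z => by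
    have := hs0 n
    rw [hf]
    dsimp only
    rw [norm_mul, Complex.norm_real, Real.norm_of_nonneg (by positivity)]
  have hfd : ∀ n, DifferentiableOn ℂ (f n) (unitBall N) := fun n =>
    (differentiableOn_testFun (hξ n) (hpos n) (hle n)).const_mul _
  have hfm : ∀ {ν : Measure (E N)}, ν (unitBall N)ᶜ = 0 → ∀ n, AEStronglyMeasurable (f n) ν :=
    fun {ν} hν n => ⟨_, (measurable_indicator_unitBall (hfd n)).stronglyMeasurable,
      (indicator_unitBall_ae_eq hν (f n)).symm⟩
  -- the test functions lie in the unit ball, since `ψ₁ (κ x) ≤ κ ψ₁ x` for `κ ≤ 1`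
  have hmod : ∀ n, modular ψ₁ (weightedVolume N α) (f n) 1 ≤ 1 := by
    intro n
    have hae : ∀ᵐ z ∂(weightedVolume N α), z ∈ unitBall N := weightedVolume_compl_unitBall α
    have h1 := hhq n
    calc modular ψ₁ (weightedVolume N α) (f n) 1
        ≤ ∫⁻ z, ENNReal.ofReal (1 / h n ^ q / C) * ENNReal.ofReal ‖testFun p (ξ n) (h n) z‖
            ∂(weightedVolume N α) := by
          refine lintegral_mono_ae ?_
          filter_upwards [hae] with z hz
          have ht := norm_testFun_le_one (p := p) (hξ n) (hpos n) (hle n) (mem_unitBall.1 hz).le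
          rw [← ENNReal.ofReal_mul (by positivity)]
          refine ENNReal.ofReal_le_ofReal ?_
          rw [div_one, hfnorm]
          have h2 := hψ₁.map_mul_le (κ := ‖testFun p (ξ n) (h n) z‖ / C) (x := s n)
            (by positivity) ((div_le_one hC0).2 (ht.trans hC)) (hs0 n).le
          rw [hs, hψ₁.map_orliczInv h1.le] at h2
          calc _ = _ := by congr 1; ring
            _ ≤ _ := h2
            _ = _ := by ring
      _ = ENNReal.ofReal (1 / h n ^ q / C) *
            ∫⁻ z, ENNReal.ofReal ‖testFun p (ξ n) (h n) z‖ ∂(weightedVolume N α) :=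
          lintegral_const_mul' _ _ ENNReal.ofReal_ne_top
      _ ≤ ENNReal.ofReal (1 / h n ^ q / C) * ENNReal.ofReal (C * h n ^ q) := by
          gcongr
          exact hint _ (hξ n) _ (hpos n) (hle n)
      _ = 1 := by
          rw [← ENNReal.ofReal_mul (by positivity), ENNReal.ofReal_eq_one]
          have : h n ^ q ≠ 0 := (Real.rpow_pos_of_pos (hpos n) q).ne'
          field_simp
  -- the test functions tend to zero pointwise, since `s n = O(h n ^ (-q))` and `p > q`
  have hf0 : ∀ z ∈ unitBall N, Tendsto (fun n => f n z) atTop (𝓝 0) := by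
    intro z hz
    have hz1 := mem_unitBall.1 hz
    obtain ⟨x₀, hx₀, hx⟩ := hψ₁.exists_le_map
    have hbound : ∀ n, ‖f n z‖ ≤ (x₀ + 1) / (1 - ‖z‖) ^ p * h n := by
      intro n
      have hn := hpos n
      have hsn : s n ≤ x₀ + 1 / h n ^ q :=
        hψ₁.orliczInv_le (hhq n).le (by have := hhq n; positivity)
          ((le_add_of_nonneg_left hx₀.le).trans (hx _ (le_add_of_nonneg_right (hhq n).le)))
      have hp1 : h n ^ p ≤ h n ^ q * h n := by
        rw [← Real.rpow_natCast]
        refine (Real.rpow_le_rpow_of_exponent_ge hn (hle n) hp).trans_eq ?_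
        rw [Real.rpow_add hn q 1, Real.rpow_one]
      have hq1 : h n ^ q ≤ 1 := Real.rpow_le_one hn.le (hle n) hq0.le
      have hqp : 0 < h n ^ q := Real.rpow_pos_of_pos hn q
      have hz2 : 0 < (1 - ‖z‖) ^ p := pow_pos (by linarith) p
      rw [hfnorm]
      calc s n / C * ‖testFun p (ξ n) (h n) z‖ ≤ s n * (h n / (1 - ‖z‖)) ^ p := by
            have := hs0 n
            gcongr
            · exact div_le_self this.le hC
            · exact norm_testFun_le (hξ n) hn (hle n) hz1
        _ ≤ (x₀ + 1 / h n ^ q) * (h n ^ q * h n / (1 - ‖z‖) ^ p) := by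
            rw [div_pow]
            gcongr
        _ = (x₀ * h n ^ q + 1) / (1 - ‖z‖) ^ p * h n := by field_simp
        _ ≤ _ := by
            gcongr
            exact mul_le_of_le_one_right hx₀.le hq1
    refine squeeze_zero_norm hbound ?_
    simpa using hlim0.const_mul ((x₀ + 1) / (1 - ‖z‖) ^ p)
  obtain ⟨g, k, hg, hk, hlim⟩ := hc.2 f fun n =>
    ⟨⟨hfd n, hfm (weightedVolume_compl_unitBall α) n, 1, one_pos,
      (hmod n).trans_lt ENNReal.one_lt_top⟩,
      (luxemburgNorm_le one_pos (hmod n)).trans_eq ENNReal.ofReal_one⟩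
  have hlim' : ∀ δ : ℝ, 0 < δ → ∀ᶠ n in atTop, modular ψ₂ μ (fun z => f (k n) z - g z) δ ≤ 1 := by
    intro δ hδ
    filter_upwards [hlim.eventually_lt_const
      (show (0 : ℝ≥0∞) < ENNReal.ofReal δ by simpa using hδ)] with n hn
    exact modular_le_one_of_luxemburgNorm_lt hψ₂ hn
  have hB : ∀ᵐ z ∂μ, z ∈ unitBall N := hμ
  have hg0 := ae_eq_zero_of_tendsto hψ₂ (fun n => hfm hμ (k n)) hg.1
    (by filter_upwards [hB] with z hz using (hf0 z hz).comp hk.tendsto_atTop) hlim'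
  -- a level `δ` at which the lower bound on the window exceeds the modular bound
  set B : ℝ := max 1 (1 / ε) with hBdef
  have hB0 : 0 < B := by positivity
  set δ : ℝ := (1 / 3) ^ p / C / (A * B) with hδ
  have hδ0 : 0 < δ := by positivity
  obtain ⟨n, hn⟩ := (hlim' δ hδ0).exists
  have hn' : modular ψ₂ μ (f (k n)) δ ≤ 1 := by
    rw [modular_congr_ae (g := fun z => f (k n) z - g z)]
    · exact hn
    · filter_upwards [hg0] with z hz
      rw [hz, sub_zero]
  set Φ : ℝ := ψ₂ (A * s (k n)) with hΦ
  have hΦ0 : 0 < Φ := hψ₂.pos (mul_pos hA (hs0 _))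
  have hmark := mul_meas_ge_le_lintegral₀ (μ := μ)
    (f := fun z => ENNReal.ofReal (ψ₂ (‖f (k n) z‖ / δ)))
    ((hψ₂.continuous_norm_div hδ0.le).measurable.comp_aemeasurable
      (hfm hμ (k n)).aemeasurable).ennreal_ofReal (ENNReal.ofReal (B * Φ))
  have hsub : carlesonWindow (ξ (k n)) (h (k n)) ⊆
      {z | ENNReal.ofReal (B * Φ) ≤ ENNReal.ofReal (ψ₂ (‖f (k n) z‖ / δ))} := by
    intro z hz
    refine ENNReal.ofReal_le_ofReal ?_
    have ht := le_norm_testFun_of_mem_carlesonWindow (p := p) (hξ (k n)) (hpos _) (hle _) hz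
    have hsk := hs0 (k n)
    have h1 : B * (A * s (k n)) ≤ ‖f (k n) z‖ / δ := by
      rw [hfnorm, hδ]
      calc B * (A * s (k n)) = s (k n) / C * (1 / 3) ^ p / ((1 / 3) ^ p / C / (A * B)) := by
            field_simp
        _ ≤ _ := by gcongr
    have h2 := hψ₂.map_mul_le (κ := B⁻¹) (x := B * (A * s (k n))) (by positivity)
      (inv_le_one_of_one_le₀ (le_max_left _ _)) (by positivity)
    rw [inv_mul_cancel_left₀ hB0.ne', inv_mul_eq_div, le_div_iff₀ hB0] at h2
    rw [mul_comm]
    exact h2.trans (hψ₂.mono (by positivity) h1)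
  have hfinal : ENNReal.ofReal (B * Φ) * ENNReal.ofReal (ε * (1 / Φ)) < 1 := by
    refine lt_of_lt_of_le ?_ ((mul_le_mul_right (measure_mono hsub) _).trans (hmark.trans hn'))
    exact ENNReal.mul_lt_mul_right (by simpa using mul_pos hB0 hΦ0) ENNReal.ofReal_ne_top
      (hbig (k n))
  rw [← ENNReal.ofReal_mul (by positivity), ENNReal.ofReal_lt_one] at hfinal
  have h1 : B * Φ * (ε * (1 / Φ)) = B * ε := by field_simp
  have h2 : 1 / ε * ε ≤ B * ε := by
    gcongr
    exact le_max_right _ _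
  rw [h1] at hfinal
  rw [div_mul_cancel₀ _ hε.ne'] at h2
  linarith

/-! ### The two conditions under the `∇₀`-condition -/

theorem KCondition.rhoCondition (hK : KCondition α ψ₁ ψ₂ μ) : RhoCondition α ψ₁ ψ₂ μ := by
  intro A hA ε hε
  obtain ⟨h₀, hh₀, H⟩ := hK.exists_rho_le hA hε
  filter_upwards [Ioo_mem_nhdsGT hh₀] with h hh
  refine (H h h hh.1 le_rfl hh.2).trans (ENNReal.ofReal_le_ofReal (le_of_eq ?_))
  have : h ^ ((N : ℝ) + 1 + α) ≠ 0 := (Real.rpow_pos_of_pos hh.1 _).ne'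
  generalize ψ₂ _ = Φ
  field_simp

/-- Iterating the `∇₀`-condition compares the growth of `ψ` from `x` to `2^m x` with its growth from
`y` to `(2C)^m y`. -/
theorem map_two_pow_div_le (hψ : IsOrlicz ψ) {x₀ C : ℝ} (hx₀ : 0 < x₀) (hC : 1 ≤ C)
    (h : ∀ x y : ℝ, x₀ ≤ x → x ≤ y → ψ (2 * x) / ψ x ≤ ψ (2 * C * y) / ψ y) (m : ℕ) {x y : ℝ}
    (hx : x₀ ≤ x) (hxy : x ≤ y) :
    ψ (2 ^ m * x) / ψ x ≤ ψ ((2 * C) ^ m * y) / ψ y := by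
  have hx0 : 0 < x := hx₀.trans_le hx
  have hy0 : 0 < y := hx0.trans_le hxy
  induction m with
  | zero => simp [(hψ.pos hx0).ne', (hψ.pos hy0).ne']
  | succ m ih =>
    have h1 : x₀ ≤ 2 ^ m * x := by
      have : (1 : ℝ) ≤ 2 ^ m := one_le_pow₀ one_le_two
      nlinarith
    have h2 : 2 ^ m * x ≤ (2 * C) ^ m * y := by
      gcongr
      linarith
    have h3 := h _ _ h1 h2
    have e1 := hψ.pos (x := 2 ^ m * x) (by positivity)
    have e2 := hψ.pos (x := (2 * C) ^ m * y) (by positivity)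
    have e3 := hψ.pos hx0
    have e4 := hψ.pos hy0
    have e5 := hψ.pos (x := 2 * (2 ^ m * x)) (by positivity)
    have e6 := hψ.pos (x := 2 * C * ((2 * C) ^ m * y)) (by positivity)
    calc ψ (2 ^ (m + 1) * x) / ψ x
        = ψ (2 * (2 ^ m * x)) / ψ (2 ^ m * x) * (ψ (2 ^ m * x) / ψ x) := by
          rw [show (2 : ℝ) ^ (m + 1) * x = 2 * (2 ^ m * x) by ring]
          field_simp
      _ ≤ ψ (2 * C * ((2 * C) ^ m * y)) / ψ ((2 * C) ^ m * y) * (ψ ((2 * C) ^ m * y) / ψ y) := by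
          gcongr
      _ = ψ ((2 * C) ^ (m + 1) * y) / ψ y := by
          rw [show (2 * C) ^ (m + 1) * y = 2 * C * ((2 * C) ^ m * y) by ring]
          field_simp

/-- The condition on `ϱ_μ` with the constant `B = (2C)^m`, where `A < 2^m`, gives the condition on
`K_{μ,α}` with the constant `A`. -/
theorem RhoCondition.kCondition (hN : 1 ≤ N) (hα : -1 < α) (hψ : IsOrlicz ψ) (hn : Nabla0 ψ)
    (hρ : RhoCondition α ψ ψ μ) : KCondition α ψ ψ μ := by
  intro A hA ε hε
  obtain ⟨x₀, hx₀, C, hC, hnab⟩ := hn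
  obtain ⟨m, hm⟩ := pow_unbounded_of_one_lt A one_lt_two
  set q := (N : ℝ) + 1 + α with hq
  have hq0 : 0 < q := by
    have : (1 : ℝ) ≤ N := by exact_mod_cast hN
    linarith
  set B : ℝ := (2 * C) ^ m with hB
  have hB0 : 0 < B := by positivity
  obtain ⟨h₀, hh₀, H⟩ := mem_nhdsGT_iff_exists_Ioo_subset.1 (hρ B hB0 ε hε)
  have hsmall : ∀ᶠ h in 𝓝[>] (0 : ℝ), h ^ q < 1 / ψ x₀ := by
    have hc : Tendsto (fun h : ℝ => h ^ q) (𝓝[>] 0) (𝓝 (0 ^ q)) :=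
      (Real.continuousAt_rpow_const 0 q (Or.inr hq0.le)).tendsto.mono_left nhdsWithin_le_nhds
    rw [Real.zero_rpow hq0.ne'] at hc
    exact hc.eventually_lt_const (one_div_pos.2 (hψ.pos hx₀))
  filter_upwards [Ioo_mem_nhdsGT hh₀, hsmall] with h hh hhs
  refine iSup₂_le fun t ht => ?_
  have ht0 : 0 < t := ht.1
  have htq : 0 < t ^ q := Real.rpow_pos_of_pos ht0 q
  have hhq : 0 < h ^ q := Real.rpow_pos_of_pos hh.1 q
  have hth : 1 / h ^ q ≤ 1 / t ^ q :=
    one_div_le_one_div_of_le htq (Real.rpow_le_rpow ht0.le ht.2 hq0.le)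
  have hρt : rho μ t ≤ ENNReal.ofReal (ε * (1 / ψ (B * orliczInv ψ (1 / t ^ q)))) :=
    H ⟨ht0, ht.2.trans_lt hh.2⟩
  set x := orliczInv ψ (1 / h ^ q) with hx
  set y := orliczInv ψ (1 / t ^ q) with hy
  have hψx : ψ x = 1 / h ^ q := hψ.map_orliczInv (by positivity)
  have hψy : ψ y = 1 / t ^ q := hψ.map_orliczInv (by positivity)
  have hxx₀ : x₀ ≤ x := by
    refine hψ.le_orliczInv (by positivity) hx₀.le ?_
    rw [le_one_div (hψ.pos hx₀) hhq]
    exact hhs.le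
  have hxy : x ≤ y := hψ.orliczInv_mono (by positivity) hth
  have hx0 : 0 < x := hx₀.trans_le hxx₀
  have hy0 : 0 < y := hx0.trans_le hxy
  rw [ENNReal.div_le_iff (by simpa using htq) ENNReal.ofReal_ne_top, ← ENNReal.ofReal_mul' htq.le]
  refine hρt.trans (ENNReal.ofReal_le_ofReal ?_)
  have hchain := map_two_pow_div_le hψ hx₀ hC hnab m hxx₀ hxy
  have hAx := hψ.pos (mul_pos hA hx0)
  have hBy := hψ.pos (mul_pos hB0 hy0)
  have hle : ψ (A * x) / ψ x ≤ ψ (B * y) / ψ y := by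
    refine le_trans ?_ hchain
    have := hψ.pos hx0
    gcongr
    exact hψ.mono (by positivity) (by gcongr)
  rw [hψy, hψx, div_le_div_iff₀ (by positivity) (by positivity)] at hle
  rw [mul_assoc]
  gcongr
  rw [div_mul_eq_mul_div, div_le_div_iff₀ hBy hAx, one_mul]
  calc ψ (A * x) = ψ (A * x) * (1 / t ^ q) * t ^ q := by field_simp
    _ ≤ ψ (B * y) * (1 / h ^ q) * t ^ q := by gcongr
    _ = _ := by ring

end BergmanOrlicz

theorem theorem2p9 (N : ℕ) (hN : 1 ≤ N) (α : ℝ) (hα : -1 < α) (ψ₁ ψ₂ : ℝ → ℝ)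
    (hψ₁ : BergmanOrlicz.IsOrlicz ψ₁) (hψ₂ : BergmanOrlicz.IsOrlicz ψ₂)
    (μ : MeasureTheory.Measure (BergmanOrlicz.E N)) [MeasureTheory.IsFiniteMeasure μ]
    (hμ : μ (BergmanOrlicz.unitBall N)ᶜ = 0) :
    (BergmanOrlicz.CompactEmbedding N α ψ₁ ψ₂ μ → BergmanOrlicz.RhoCondition α ψ₁ ψ₂ μ) ∧
    (BergmanOrlicz.KCondition α ψ₁ ψ₂ μ → BergmanOrlicz.CompactEmbedding N α ψ₁ ψ₂ μ) ∧
    (ψ₁ = ψ₂ → BergmanOrlicz.Nabla0 ψ₁ →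
      (BergmanOrlicz.RhoCondition α ψ₁ ψ₂ μ ↔ BergmanOrlicz.KCondition α ψ₁ ψ₂ μ)) := by
  refine ⟨fun h => h.rhoCondition hN hα hψ₁ hψ₂ hμ,
    fun h => h.compactEmbedding hN hα hψ₁ hψ₂ hμ, ?_⟩
  rintro rfl hn
  exact ⟨fun h => h.kCondition hN hα hψ₁ hn, fun h => h.rhoCondition⟩
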